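/- Consider the interacting Pólya urn model of $n$ agents $i\in[n]=\{1,\dots,n\}$. Let $A=(a_{i,j})\in\mathbb R^{n\times n}$ be a symmetric matrix of nonnegative edge weights (self-loops allowed), let $\deg(i)=\sum_j a_{i,j}$, $D=\mathrm{diag}(\deg(1),\dots,\deg(n))$, and suppose that $W=D^{-1}A$ is irreducible (the graph is connected). Let $\gamma_i\in(0,\infty)$, $\gamma_i\neq 1$, be bias parameters, $\Gamma=\mathrm{diag}(\gamma_1,\dots,\gamma_n)$, and let $b_i^0,b_i^1>0$ with $b_i^0+b_i^1=1$ be initial settings. At each time $t=2,3,\dots$ every agent $i$ declares an opinion $\psi_{i,t}\in\{0,1\}$. For $t\ge 1$ put $$\beta_i(t)=\frac1t\Big(b_i^1+\sum_{\tau=2}^t\psi_{i,\tau}\Big),\qquad \mu_i(t)=\frac1{\deg(i)}\sum_{j=1}^n a_{i,j}\beta_j(t).$$ Conditionally on all declarations up to time $t\ge1$, the declarations $\psi_{1,t+1},\dots,\psi_{n,t+1}$ are independent, and $\psi_{i,t+1}=1$ with probability $f(\mu_i(t),\gamma_i)$, where $f(\mu,\gamma)=\frac{\gamma\mu}{1+(\gamma-1)\mu}$.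 Let $\lambda$ be the largest eigenvalue of $\Gamma W$ (all of whose eigenvalues are real), and suppose that $\lambda<1$ (the regime of consensus to $\mathbf 0$). Then for every agent $i\in[n]$ and every $\epsilon>0$, almost surely $$\lim_{t\to\infty}\frac{\beta_i(t)}{t^{\lambda-1+\epsilon}}=0\qquad\text{and}\qquad\lim_{t\to\infty}\frac{\beta_i(t)}{t^{\lambda-1-\epsilon}}=\infty .$$ -/

import Mathlib

open Filter Topology MeasureTheory

noncomputable section

/-- The weighted degrees `deg(i) = ∑ j, a i j` of a weight matrix. -/
def weightedDegree {n : ℕ} (A : Matrix (Fin n) (Fin n) ℝ) (i : Fin n) : ℝ :=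
  ∑ j, A i j

/-- The normalized adjacency matrix `W = D⁻¹ A`, where `D` is the diagonal matrix of degrees. -/
def normalizedAdjacency {n : ℕ} (A : Matrix (Fin n) (Fin n) ℝ) : Matrix (Fin n) (Fin n) ℝ :=
  Matrix.diagonal (fun i => (weightedDegree A i)⁻¹) * A

/-- The largest (real) eigenvalue of a square matrix. It is used for matrices all of whose
eigenvalues are real. -/
def lambdaMax {n : ℕ} (M : Matrix (Fin n) (Fin n) ℝ) : ℝ :=
  sSup {x : ℝ | Module.End.HasEigenvalue (Matrix.toLin' M) x}

/-- The parameters of an interacting Pólya urn model of `n` agents: a connected weighted undirected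
graph (possibly with self-loops), the bias parameters and the initial settings `b¹`
(with `b⁰ = 1 - b¹`). -/
structure UrnModel (n : ℕ) where
  /-- the edge weights; `weight i j = 0` when there is no edge -/
  weight : Matrix (Fin n) (Fin n) ℝ
  weight_symm : weight.IsSymm
  weight_nonneg : ∀ i j, 0 ≤ weight i j
  irreducible : (normalizedAdjacency weight).IsIrreducible
  /-- the bias parameters -/
  bias : Fin n → ℝ
  bias_pos : ∀ i, 0 < bias i
  bias_ne_one : ∀ i, bias i ≠ 1
  /-- the initial settings towards opinion `1` -/
  init : Fin n → ℝ
  init_pos : ∀ i, 0 < init i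
  init_lt_one : ∀ i, init i < 1

/-- A record `h` of declared opinions: `h t i` is the opinion declared by agent `i` at time `t`,
where `true` is opinion `1` and `false` is opinion `0`. Declarations start at time `2`; the initial
settings stand in for the declarations at time `1`, and the values at times `0` and `1` are never
used. -/
abbrev Declarations (n : ℕ) := ℕ → Fin n → Bool

/-- `f(μ, γ) = γ μ / (1 + (γ - 1) μ)`. -/
def biasedProb (μ γ : ℝ) : ℝ := γ * μ / (1 + (γ - 1) * μ)

namespace UrnModel

variable {n : ℕ} (N : UrnModel n)

/-- `β i (t)`, the time-averaged declarations of opinion `1` by agent `i` up to time `t ≥ 1`. -/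
def beta (h : Declarations n) (i : Fin n) (t : ℕ) : ℝ :=
  (N.init i + ∑ τ ∈ Finset.Icc 2 t, if h τ i = true then 1 else 0) / t

/-- `M⁰ i (t)`: the weighted number of `0`s observed by agent `i` up to time `t`, plus the initial
setting `m⁰ i = ∑ j, a i j * b⁰ j`. -/
def count0 (h : Declarations n) (i : Fin n) (t : ℕ) : ℝ :=
  ∑ j, N.weight i j * (1 - N.init j) +
    ∑ τ ∈ Finset.Icc 2 t, ∑ j, N.weight i j * if h τ j = false then 1 else 0

/-- `M¹ i (t)`: the weighted number of `1`s observed by agent `i` up to time `t`, plus the initial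
setting `m¹ i = ∑ j, a i j * b¹ j`. -/
def count1 (h : Declarations n) (i : Fin n) (t : ℕ) : ℝ :=
  ∑ j, N.weight i j * N.init j +
    ∑ τ ∈ Finset.Icc 2 t, ∑ j, N.weight i j * if h τ j = true then 1 else 0

/-- `μ i (t)`: the weighted proportion of `1`s observed by agent `i` up to time `t`. -/
def mu (h : Declarations n) (i : Fin n) (t : ℕ) : ℝ :=
  N.count1 h i t / (N.count0 h i t + N.count1 h i t)

/-- `f(μ i (t), γ i)`: the probability that agent `i` declares `1` at time `t + 1`, given the
declarations up to time `t`. -/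
def declareOneProb (h : Declarations n) (i : Fin n) (t : ℕ) : ℝ :=
  biasedProb (N.mu h i t) (N.bias i)

/-- The matrix `Γ W`, where `Γ` is the diagonal matrix of the bias parameters. -/
def jacobianZero : Matrix (Fin n) (Fin n) ℝ :=
  Matrix.diagonal N.bias * normalizedAdjacency N.weight

end UrnModel

/-- The history of a process of declarations up to time `t`: the σ-algebra generated by all
declarations at the times `2, …, t`. -/
@[reducible] def historySigma {n : ℕ} {Ω : Type*} (ψ : Ω → Declarations n) (t : ℕ) : MeasurableSpace Ω :=
  ⨆ τ ∈ Set.Icc 2 t, ⨆ i : Fin n, MeasurableSpace.comap (fun ω => ψ ω τ i) ⊤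

/-- `ψ` is a process of declared opinions of the model `N` under `P`: conditionally on the history
up to any time `t ≥ 1`, the declarations of the agents at time `t + 1` are independent, and agent
`i` declares `1` with probability `f(μ i (t), γ i)` and `0` otherwise. -/
structure IsDeclarationProcess {n : ℕ} (N : UrnModel n) {Ω : Type*} [MeasurableSpace Ω]
    (P : Measure Ω) (ψ : Ω → Declarations n) : Prop where
  measurable : ∀ t : ℕ, 2 ≤ t → ∀ i : Fin n, Measurable fun ω => ψ ω t i
  cond_law : ∀ t : ℕ, 1 ≤ t → ∀ x : Fin n → Bool,
    P[Set.indicator {ω | ∀ i, ψ ω (t + 1) i = x i} (fun _ => (1 : ℝ)) | historySigma ψ t]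
      =ᵐ[P] fun ω => ∏ i, if x i = true then N.declareOneProb (ψ ω) i t
        else 1 - N.declareOneProb (ψ ω) i t

end

noncomputable section

/-! Near consensus at `0` the counts of ones nearly satisfy the linear recursion S(t+1) = S(t) + Γ W
S(t) / t, whose growth exponent is the Perron eigenvalue l of Γ W. With a positive eigenvector v,
the vectors v t^a are eventually supersolutions for a > l and subsolutions for a < l. This traps the
counts between t^(l-δ) and t^(l+δ) up to constants (`exists_rpow_le`, `exists_le_rpow`), and
division by t gives both limits.

Probability enters only once. By a ratio form of the conditional Borel–Cantelli lemma
(`ae_tendsto_sum_div_sum`), almost surely the count of each opinion of each agent is asymptotic to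
the sum of its conditional probabilities; this sum diverges because the initial settings keep the
probabilities above c / t. The rest is deterministic on such a path, and `UrnTrajectory` records
what it needs.

Consensus itself has to be derived from l < 1. First the zeros grow linearly
(`exists_linear_le_right`), so the odds B i / C i are bounded by r v i for some r. The rule f
multiplies odds by γ i, and odds are convex in the proportion, so one pass through the recursion
improves r by a factor close to l (`odds_le_improve`); iteration drives r to 0. -/

/-! ### Perron theory for symmetrizable nonnegative matrices. -/

theorem Matrix.IsIrreducible.forall_of_exists {ι : Type*} {W : Matrix ι ι ℝ}
    (hW : W.IsIrreducible) {p : ι → Prop} (hp : ∀ i j, 0 < W i j → p j → p i)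
    (h : ∃ j, p j) (i : ι) : p i := by
  obtain ⟨j, hj⟩ := h
  let : Quiver ι := W.toQuiver
  obtain ⟨q, -⟩ := hW.connected i j
  induction q with
  | nil => exact hj
  | cons q e ih => exact ih (hp _ _ e.down hj)

/-- Irreducibility supplies a closed path of positive length at i, which needs an arrow leaving i;
this also covers a single vertex. -/
theorem Matrix.IsIrreducible.exists_entry_pos {ι : Type*} {W : Matrix ι ι ℝ}
    (hW : W.IsIrreducible) (i : ι) : ∃ j, 0 < W i j := by
  by_contra! h
  let : Quiver ι := W.toQuiver
  obtain ⟨q, hq⟩ := hW.connected i i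
  have : ∀ {k : ι} (q : Quiver.Path i k), ¬ 0 < q.length := by
    intro k q
    induction q with
    | nil => simp
    | @cons b c q e ih =>
      have h0 : q.length = 0 := by omega
      have : i = b := Quiver.Path.eq_of_length_zero q h0
      subst this
      exact absurd e.down (not_lt.2 (h _))
  exact this q hq

/-- Perron's theorem for a product of a positive diagonal matrix and a symmetric nonnegative
matrix whose positive entries form a strongly connected graph. -/
theorem exists_pos_eigenvector_lambdaMax {n : ℕ} [NeZero n] {A W : Matrix (Fin n) (Fin n) ℝ}
    (hA : A.IsSymm) (hA0 : ∀ i j, 0 ≤ A i j) {s : Fin n → ℝ} (hs : ∀ i, 0 < s i)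
    (hW : W.IsIrreducible) (hWA : ∀ i j, 0 < W i j → 0 < A i j) :
    0 < lambdaMax (Matrix.diagonal s * A) ∧ ∃ v : Fin n → ℝ, (∀ i, 0 < v i) ∧
      ∀ i, s i * ∑ j, A i j * v j = lambdaMax (Matrix.diagonal s * A) * v i := by
  set M := Matrix.diagonal s * A with hM
  have hMv : ∀ (v : Fin n → ℝ) i, (M.mulVec v) i = s i * ∑ j, A i j * v j := by
    intro v i
    simp [hM, Matrix.mulVec, dotProduct, Matrix.diagonal_mul, Finset.mul_sum, mul_assoc]
  set r : Fin n → ℝ := fun i => Real.sqrt (s i) with hr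
  have hr0 : ∀ i, 0 < r i := fun i => Real.sqrt_pos.2 (hs i)
  have hrs : ∀ i, r i * r i = s i := fun i => Real.mul_self_sqrt (hs i).le
  -- With r = √s, M is similar to the symmetric matrix T, which brings in the spectral theorem;
  -- scaling by r carries eigenvectors of T to those of M.
  set T : Matrix (Fin n) (Fin n) ℝ := Matrix.of fun i j => r i * A i j * r j with hT
  have hTv : ∀ (v : Fin n → ℝ) i, (T.mulVec v) i = r i * ∑ j, A i j * (r j * v j) := by
    intro v i
    simp [hT, Matrix.mulVec, dotProduct, Finset.mul_sum, mul_assoc]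
  have hTsymm : T.IsHermitian := by
    ext i j
    simp [hT, hA.apply i j]; ring
  have eig : ∀ (x : ℝ) (y : Fin n → ℝ), T.mulVec y = x • y →
      M.mulVec (fun i => r i * y i) = x • fun i => r i * y i := by
    intro x y h
    ext i
    have := congrFun h i
    rw [hTv] at this
    rw [hMv, ← hrs i, mul_assoc, this]
    simp; ring
  have hasEig : ∀ (x : ℝ) (y : Fin n → ℝ), y ≠ 0 → T.mulVec y = x • y →
      Module.End.HasEigenvalue (Matrix.toLin' M) x := by
    intro x y hy h
    refine Module.End.hasEigenvalue_of_hasEigenvector (x := fun i => r i * y i)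
      (Module.End.hasEigenvector_iff.2 ⟨Module.End.mem_eigenspace_iff.2 ?_, ?_⟩)
    · rw [Matrix.toLin'_apply]; exact eig x y h
    · intro h0
      apply hy
      ext i
      have := congrFun h0 i
      simpa [(hr0 i).ne'] using this
  set E : Set ℝ := {x : ℝ | Module.End.HasEigenvalue (Matrix.toLin' M) x} with hE
  have hfin : E.Finite := Module.End.finite_hasEigenvalue _
  have hne : E.Nonempty := by
    refine ⟨hTsymm.eigenvalues 0, hasEig _ (hTsymm.eigenvectorBasis 0) ?_
      (hTsymm.mulVec_eigenvectorBasis 0)⟩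
    intro h0
    apply hTsymm.eigenvectorBasis.toBasis.ne_zero 0
    ext i
    simpa using congrFun h0 i
  have hmem : sSup E ∈ E := hne.csSup_mem hfin
  have hlam : lambdaMax M = sSup E := rfl
  rw [hlam]
  set l := sSup E with hl
  have hle : ∀ x ∈ E, x ≤ l := fun x hx => le_csSup hfin.bddAbove hx
  -- the eigenvector for `T`
  obtain ⟨x, hx⟩ := Module.End.HasEigenvalue.exists_hasEigenvector hmem
  have hx0 : x ≠ 0 := hx.2
  have hxe : M.mulVec x = l • x := by
    have := hx.apply_eq_smul
    rwa [Matrix.toLin'_apply] at this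
  set y : Fin n → ℝ := fun i => x i / r i with hy
  have hxy : ∀ i, r i * y i = x i := fun i => by
    simp only [hy]; field_simp [(hr0 i).ne']
  have hTy : T.mulVec y = l • y := by
    ext i
    have h1 := congrFun hxe i
    rw [hMv, ← hrs i] at h1
    rw [hTv]
    simp only [hxy, Pi.smul_apply, smul_eq_mul] at h1 ⊢
    have : r i * (r i * ∑ j, A i j * x j) = r i * (l * y i) := by
      rw [← mul_assoc, h1, ← hxy i]; ring
    exact mul_left_cancel₀ (hr0 i).ne' this
  have hQsymm : (l • (1 : Matrix (Fin n) (Fin n) ℝ) - T).IsHermitian :=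
    (by simp [Matrix.IsHermitian] : (l • (1 : Matrix (Fin n) (Fin n) ℝ)).IsHermitian).sub hTsymm
  -- An eigenvalue of l - T is l minus an eigenvalue of T, hence of M, and l is the largest of
  -- these.
  have hQ : (l • (1 : Matrix (Fin n) (Fin n) ℝ) - T).PosSemidef := by
    rw [hQsymm.posSemidef_iff_eigenvalues_nonneg]
    intro k
    have h1 := hQsymm.mulVec_eigenvectorBasis k
    have h2 : T.mulVec (hQsymm.eigenvectorBasis k) =
        (l - hQsymm.eigenvalues k) • (hQsymm.eigenvectorBasis k : Fin n → ℝ) := by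
      rw [Matrix.sub_mulVec, Matrix.smul_mulVec, Matrix.one_mulVec] at h1
      rw [sub_smul, ← h1]; simp
    have h3 := hle _ (hasEig _ _ (by
      intro h0
      apply hQsymm.eigenvectorBasis.toBasis.ne_zero k
      ext i
      simpa using congrFun h0 i) h2)
    simpa using h3
  set z : Fin n → ℝ := fun i => |y i| with hz
  have hQv : ∀ w : Fin n → ℝ, dotProduct (star w)
      ((l • (1 : Matrix (Fin n) (Fin n) ℝ) - T).mulVec w) =
      l * ∑ i, w i * w i - ∑ i, ∑ j, r i * A i j * r j * (w i * w j) := by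
    intro w
    rw [Matrix.sub_mulVec, Matrix.smul_mulVec, Matrix.one_mulVec, dotProduct_sub]
    congr 1
    · simp only [dotProduct, Finset.mul_sum]
      refine Finset.sum_congr rfl fun i _ => ?_
      simp; ring
    · simp only [dotProduct, hT, Matrix.mulVec, Matrix.of_apply, Finset.mul_sum]
      refine Finset.sum_congr rfl fun i _ => Finset.sum_congr rfl fun j _ => ?_
      simp; ring
  -- Since the entries are nonnegative, the form at |y| is at most its value 0 at y; a positive
  -- semidefinite form vanishes only on its kernel.
  have hQz : (l • (1 : Matrix (Fin n) (Fin n) ℝ) - T).mulVec z = 0 := by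
    rw [← hQ.dotProduct_mulVec_zero_iff]
    apply le_antisymm _ (hQ.dotProduct_mulVec_nonneg z)
    have hy0 : (l • (1 : Matrix (Fin n) (Fin n) ℝ) - T).mulVec y = 0 := by
      rw [Matrix.sub_mulVec, Matrix.smul_mulVec, Matrix.one_mulVec, hTy, sub_self]
    have h1 := hQv y
    rw [hy0, dotProduct_zero] at h1
    rw [hQv, h1]
    have e1 : ∀ i, z i * z i = y i * y i := fun i => abs_mul_abs_self _
    simp only [e1]
    refine sub_le_sub_left (Finset.sum_le_sum fun i _ => Finset.sum_le_sum fun j _ =>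
      mul_le_mul_of_nonneg_left ?_ (mul_nonneg (mul_nonneg (hr0 i).le (hA0 i j)) (hr0 j).le)) _
    simp only [hz]
    rw [← abs_mul]
    exact le_abs_self _
  have hTz : T.mulVec z = l • z := by
    rw [Matrix.sub_mulVec, Matrix.smul_mulVec, Matrix.one_mulVec, sub_eq_zero] at hQz
    exact hQz.symm
  have hMz := eig l z hTz
  set v : Fin n → ℝ := fun i => r i * z i with hv
  have hv0 : ∀ i, 0 ≤ v i := fun i => mul_nonneg (hr0 i).le (abs_nonneg _)
  have heq : ∀ i, s i * ∑ j, A i j * v j = l * v i := fun i => by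
    rw [← hMv, hMz]; rfl
  -- The eigenvalue equation passes positivity from j to i along W i j > 0, so irreducibility leaves
  -- no zero coordinate.
  have hlv : ∀ i j, 0 < W i j → 0 < v j → 0 < l * v i := by
    intro i j hij hj
    rw [← heq]
    exact mul_pos (hs i) (Finset.sum_pos' (fun k _ => mul_nonneg (hA0 i k) (hv0 k))
      ⟨j, Finset.mem_univ _, mul_pos (hWA i j hij) hj⟩)
  have hex : ∃ j, 0 < v j := by
    by_contra! h
    apply hx0
    ext i
    have h1 : v i = 0 := le_antisymm (h i) (hv0 i)
    have h2 : y i = 0 := by simpa [hv, hz, (hr0 i).ne'] using h1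
    simp [← hxy, h2]
  have hvpos : ∀ i, 0 < v i := hW.forall_of_exists (p := fun i => 0 < v i) (fun i j hij hj =>
    lt_of_le_of_ne (hv0 i) fun h => by simpa [← h] using hlv i j hij hj) hex
  refine ⟨?_, v, hvpos, heq⟩
  obtain ⟨j, hj⟩ := hW.exists_entry_pos 0
  exact (pos_iff_pos_of_mul_pos (hlv 0 j hj (hvpos j))).2 (hvpos 0)

/-! ### A mean inequality and the increments of powers. -/

/-- Weighted harmonic-arithmetic mean inequality. -/
theorem inv_sum_mul_le_sum_mul_inv {ι : Type*} [Fintype ι] {w x : ι → ℝ} (hw : ∀ j, 0 ≤ w j)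
    (hw1 : ∑ j, w j = 1) (hx : ∀ j, 0 < x j) :
    (∑ j, w j * x j)⁻¹ ≤ ∑ j, w j * (x j)⁻¹ := by
  set c := ∑ j, w j * x j with hc
  have hc0 : 0 < c := by
    refine lt_of_le_of_ne (Finset.sum_nonneg fun j _ => mul_nonneg (hw j) (hx j).le) fun h => ?_
    have h0 := (Finset.sum_eq_zero_iff_of_nonneg
      fun j _ => mul_nonneg (hw j) (hx j).le).1 (hc.symm.trans h.symm)
    have : ∀ j, w j = 0 := fun j => by simpa [(hx j).ne'] using h0 j (Finset.mem_univ j)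
    simp [this] at hw1
  -- The tangent of 1/x at the mean c lies below the graph, and its weighted average is 1/c.
  have h1 : ∀ j, w j * (2 * c⁻¹ - x j * (c⁻¹ * c⁻¹)) ≤ w j * (x j)⁻¹ := by
    intro j
    refine mul_le_mul_of_nonneg_left ?_ (hw j)
    have h2 : (x j)⁻¹ - (2 * c⁻¹ - x j * (c⁻¹ * c⁻¹)) = x j * ((x j)⁻¹ - c⁻¹) ^ 2 := by
      have := (hx j).ne'
      field_simp
      ring
    have h3 : 0 ≤ x j * ((x j)⁻¹ - c⁻¹) ^ 2 := mul_nonneg (hx j).le (sq_nonneg _)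
    linarith
  calc c⁻¹ = (∑ j, w j) * (2 * c⁻¹) - c * (c⁻¹ * c⁻¹) := by
        rw [hw1, ← mul_assoc c, mul_inv_cancel₀ hc0.ne']; ring
    _ = ∑ j, w j * (2 * c⁻¹ - x j * (c⁻¹ * c⁻¹)) := by
        rw [hc, Finset.sum_mul, Finset.sum_mul, ← Finset.sum_sub_distrib]
        exact Finset.sum_congr rfl fun j _ => by ring
    _ ≤ _ := Finset.sum_le_sum fun j _ => h1 j

/-- The limit is the derivative of x ^ a at 1, taken along the points 1 + 1/t. -/
theorem tendsto_nat_mul_rpow_sub_one (a : ℝ) :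
    Tendsto (fun t : ℕ => (t : ℝ) * ((1 + 1 / (t : ℝ)) ^ a - 1)) atTop (𝓝 a) := by
  have h1 : HasDerivAt (fun x : ℝ => x ^ a) a 1 := by
    simpa using Real.hasDerivAt_rpow_const (x := 1) (p := a) (Or.inl one_ne_zero)
  have h2 := h1.tendsto_slope
  have h3 : Tendsto (fun t : ℕ => 1 + 1 / (t : ℝ)) atTop (𝓝[≠] 1) := by
    refine tendsto_nhdsWithin_iff.2 ⟨?_, ?_⟩
    · simpa using (tendsto_const_nhds (x := (1 : ℝ))).add tendsto_one_div_atTop_nhds_zero_nat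
    · filter_upwards [eventually_gt_atTop 0] with t ht
      simp [ht.ne']
  refine (h2.comp h3).congr fun t => ?_
  simp [slope_def_field, div_eq_mul_inv, mul_comm]

theorem succ_rpow_eq {t : ℕ} (ht : 0 < t) (a : ℝ) :
    ((t + 1 : ℕ) : ℝ) ^ a = (t : ℝ) ^ a * (1 + 1 / (t : ℝ)) ^ a := by
  have h : (0 : ℝ) < t := Nat.cast_pos.2 ht
  rw [← Real.mul_rpow h.le (by positivity)]
  congr 1
  push_cast
  field_simp

/-- The gap between a and b absorbs the higher-order terms, so that t ^ a becomes a barrier for the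
recursion x(t+1) = x(t) + b x(t) / t. -/
theorem eventually_succ_rpow_le {a b : ℝ} (hab : a < b) :
    ∀ᶠ t : ℕ in atTop, ((t + 1 : ℕ) : ℝ) ^ a ≤ (t : ℝ) ^ a + b * (t : ℝ) ^ a / t := by
  filter_upwards [(tendsto_nat_mul_rpow_sub_one a).eventually_le_const hab,
    eventually_gt_atTop 0] with t h ht
  have h0 : (0 : ℝ) < t := Nat.cast_pos.2 ht
  rw [succ_rpow_eq ht]
  have h1 : (1 + 1 / (t : ℝ)) ^ a ≤ 1 + b / t := by
    rw [← sub_le_iff_le_add', le_div_iff₀ h0]; linarith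
  calc _ ≤ (t : ℝ) ^ a * (1 + b / t) := by gcongr
    _ = _ := by ring

theorem eventually_le_succ_rpow {a b : ℝ} (hab : b < a) :
    ∀ᶠ t : ℕ in atTop, (t : ℝ) ^ a + b * (t : ℝ) ^ a / t ≤ ((t + 1 : ℕ) : ℝ) ^ a := by
  filter_upwards [(tendsto_nat_mul_rpow_sub_one a).eventually_const_le hab,
    eventually_gt_atTop 0] with t h ht
  have h0 : (0 : ℝ) < t := Nat.cast_pos.2 ht
  rw [succ_rpow_eq ht]
  have h1 : 1 + b / t ≤ (1 + 1 / (t : ℝ)) ^ a := by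
    rw [← le_sub_iff_add_le', div_le_iff₀ h0]; linarith
  calc _ = (t : ℝ) ^ a * (1 + b / t) := by ring
    _ ≤ _ := by gcongr

/-! ### Deterministic urn trajectories. -/

/-- A trajectory of an urn system: `B` and `C` are the numbers of draws of the two colours, `S` and
`R` their accumulated conditional expectations, which are asymptotically equivalent to them. -/
structure UrnTrajectory {ι : Type*} [Fintype ι] (W : ι → ι → ℝ) (γ : ι → ℝ)
    (B C S R : ι → ℕ → ℝ) : Prop where
  weight_nonneg : ∀ i j, 0 ≤ W i j
  weight_sum : ∀ i, ∑ j, W i j = 1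
  bias_pos : ∀ i, 0 < γ i
  pos_left : ∀ i t, 0 < B i t
  pos_right : ∀ i t, 0 < C i t
  add_eq : ∀ i (t : ℕ), 1 ≤ t → B i t + C i t = t
  succ_left : ∀ i t, 1 ≤ t → S i (t + 1) = S i t +
    γ i * (∑ j, W i j * B j t) / (γ i * ∑ j, W i j * B j t + ∑ j, W i j * C j t)
  succ_right : ∀ i t, 1 ≤ t → R i (t + 1) = R i t +
    (∑ j, W i j * C j t) / (γ i * ∑ j, W i j * B j t + ∑ j, W i j * C j t)
  tendsto_left : ∀ i, Tendsto (S i) atTop atTop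
  tendsto_right : ∀ i, Tendsto (R i) atTop atTop
  ratio_left : ∀ i, Tendsto (fun t => B i t / S i t) atTop (𝓝 1)
  ratio_right : ∀ i, Tendsto (fun t => C i t / R i t) atTop (𝓝 1)

namespace UrnTrajectory

variable {ι : Type*} [Fintype ι] {W : ι → ι → ℝ} {γ : ι → ℝ} {B C S R : ι → ℕ → ℝ}

theorem sum_add_sum (h : UrnTrajectory W γ B C S R) (i : ι) {t : ℕ} (ht : 1 ≤ t) :
    ∑ j, W i j * B j t + ∑ j, W i j * C j t = t := by
  rw [← Finset.sum_add_distrib]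
  simp_rw [← mul_add, h.add_eq _ t ht, ← Finset.sum_mul, h.weight_sum, one_mul]

theorem sum_pos (h : UrnTrajectory W γ B C S R) (i : ι) {x : ι → ℝ} (hx : ∀ j, 0 < x j) :
    0 < ∑ j, W i j * x j := by
  refine lt_of_le_of_ne
    (Finset.sum_nonneg fun j _ => mul_nonneg (h.weight_nonneg i j) (hx j).le) fun h' => ?_
  have h0 := (Finset.sum_eq_zero_iff_of_nonneg
    fun j _ => mul_nonneg (h.weight_nonneg i j) (hx j).le).1 h'.symm
  have : ∀ j, W i j = 0 := fun j => by simpa [(hx j).ne'] using h0 j (Finset.mem_univ j)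
  simpa [this] using h.weight_sum i

theorem sum_le (h : UrnTrajectory W γ B C S R) (i : ι) {x y : ι → ℝ} (hx : ∀ j, x j ≤ y j) :
    ∑ j, W i j * x j ≤ ∑ j, W i j * y j :=
  Finset.sum_le_sum fun j _ => mul_le_mul_of_nonneg_left (hx j) (h.weight_nonneg i j)

theorem eventually_right_ge (h : UrnTrajectory W γ B C S R) {b : ℝ} (hb : b < 1) :
    ∀ᶠ t in atTop, ∀ i, b * R i t ≤ C i t := by
  refine eventually_all.2 fun i => ?_
  filter_upwards [(h.ratio_right i).eventually_const_le hb,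
    (h.tendsto_right i).eventually_gt_atTop 0] with t h1 h2
  exact (le_div_iff₀ h2).1 h1

theorem eventually_left_ge (h : UrnTrajectory W γ B C S R) {b : ℝ} (hb : b < 1) :
    ∀ᶠ t in atTop, ∀ i, b * S i t ≤ B i t := by
  refine eventually_all.2 fun i => ?_
  filter_upwards [(h.ratio_left i).eventually_const_le hb,
    (h.tendsto_left i).eventually_gt_atTop 0] with t h1 h2
  exact (le_div_iff₀ h2).1 h1

theorem eventually_left_le (h : UrnTrajectory W γ B C S R) {b : ℝ} (hb : 1 < b) :
    ∀ᶠ t in atTop, ∀ i, B i t ≤ b * S i t := by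
  refine eventually_all.2 fun i => ?_
  filter_upwards [(h.ratio_left i).eventually_le_const hb,
    (h.tendsto_left i).eventually_gt_atTop 0] with t h1 h2
  exact (div_le_iff₀ h2).1 h1

/-! ### Consensus from l < 1. -/

variable {v : ι → ℝ} {l : ℝ}

/-- In the regime of an attracting `0`, the second colour grows linearly. -/
theorem exists_linear_le_right (h : UrnTrajectory W γ B C S R) (hv : ∀ i, 0 < v i) (hl0 : 0 < l)
    (hl : l < 1) (hev : ∀ i, γ i * ∑ j, W i j * v j = l * v i) (i : ι) :
    ∃ c > 0, ∀ᶠ t : ℕ in atTop, c * t ≤ C i t := by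
  -- Here l = 1 - 2θ ≤ (1 - θ)²: one factor 1 - θ pays for comparing `C` with `R`, the other leaves
  -- a share θ k for the summand k of the denominator.
  set θ := (1 - l) / 2 with hθ
  have hθ0 : 0 < θ := by rw [hθ]; linarith
  obtain ⟨T, hT⟩ := eventually_atTop.1 ((h.eventually_right_ge (b := 1 - θ) (by linarith)).and
    ((eventually_all.2 fun i => (h.tendsto_right i).eventually_gt_atTop 0).and
      (eventually_ge_atTop 1)))
  obtain ⟨c, hc⟩ : ∃ c : ℝ, (∀ i, c * (v i)⁻¹ ≤ θ ∧ c * (v i)⁻¹ * T ≤ R i T) ∧ 0 < c := by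
    have : ∀ᶠ c : ℝ in 𝓝[>] 0, ∀ i, c * (v i)⁻¹ ≤ θ ∧ c * (v i)⁻¹ * T ≤ R i T := by
      refine eventually_nhdsWithin_of_eventually_nhds (eventually_all.2 fun i => ?_)
      have h1 : Tendsto (fun c : ℝ => c * (v i)⁻¹) (𝓝 0) (𝓝 0) := by
        simpa using (tendsto_id (x := 𝓝 (0 : ℝ))).mul_const (v i)⁻¹
      have h2 : Tendsto (fun c : ℝ => c * (v i)⁻¹ * T) (𝓝 0) (𝓝 0) := by
        simpa using h1.mul_const (T : ℝ)
      exact (h1.eventually_le_const hθ0).and (h2.eventually_le_const ((hT T le_rfl).2.1 i))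
    exact (this.and self_mem_nhdsWithin).exists
  obtain ⟨hc, hc0⟩ := hc
  -- The reciprocal of v suits the zeros: the average of 1 / v j is at least 1 / ∑ W i j v j = γ i /
  -- (l v i). The ones enter only through m ≤ t.
  have key : ∀ t ≥ T, ∀ i, c * (v i)⁻¹ * t ≤ R i t := by
    intro t ht
    induction t, ht using Nat.le_induction with
    | base => exact fun i => (hc i).2
    | succ t ht ih =>
      intro i
      obtain ⟨h1, -, h3⟩ := hT t ht
      have ht0 : (0 : ℝ) < t := Nat.cast_pos.2 h3
      rw [h.succ_right i t h3]
      set k := ∑ j, W i j * C j t with hk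
      set m := ∑ j, W i j * B j t with hm
      have hm0 : 0 < m := h.sum_pos i fun j => h.pos_left j t
      have hk0 : 0 < k := h.sum_pos i fun j => h.pos_right j t
      have hmk : m + k = t := h.sum_add_sum i h3
      have hg := h.bias_pos i
      have hVpos : 0 < ∑ j, W i j * v j := h.sum_pos i hv
      have hk1 : (1 - θ) * c * t * ∑ j, W i j * (v j)⁻¹ ≤ k := by
        rw [Finset.mul_sum]
        refine le_trans (le_of_eq ?_) (h.sum_le i (x := fun j => (1 - θ) * (c * (v j)⁻¹ * t))
          fun j => le_trans ?_ (h1 j))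
        · exact Finset.sum_congr rfl fun j _ => by ring
        · exact mul_le_mul_of_nonneg_left (ih j) (by rw [hθ]; linarith)
      have hJ := inv_sum_mul_le_sum_mul_inv (h.weight_nonneg i) (h.weight_sum i) hv
      have hV : (∑ j, W i j * v j)⁻¹ = γ i / (l * v i) := by
        rw [← hev i]; field_simp
      rw [hV] at hJ
      have hk2 : (1 - θ) * c * t * (γ i / (l * v i)) ≤ k := le_trans
        (mul_le_mul_of_nonneg_left hJ (by
          have : 0 < 1 - θ := by rw [hθ]; linarith
          positivity)) hk1
      set x := c * (v i)⁻¹ with hx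
      have hx0 : 0 < x := mul_pos hc0 (inv_pos.2 (hv i))
      have hk3 : (1 - θ) * x * t * γ i ≤ l * k := by
        have : (1 - θ) * c * t * (γ i / (l * v i)) = (1 - θ) * x * t * γ i / l := by
          rw [hx]; field_simp
        rw [this, div_le_iff₀ hl0] at hk2
        linarith
      have hstep : x ≤ k / (γ i * m + k) := by
        rw [le_div_iff₀ (by positivity)]
        have e1 : x * (γ i * m) ≤ x * γ i * t := by
          rw [mul_assoc x]
          exact mul_le_mul_of_nonneg_left (mul_le_mul_of_nonneg_left (by linarith) hg.le) hx0.le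
        have e2 : (1 - θ) * (x * γ i * t) ≤ l * k := by linarith
        have e3 : x * k ≤ θ * k := mul_le_mul_of_nonneg_right (hc i).1 hk0.le
        have e4 : x * γ i * t ≤ (1 - θ) * k := by
          have h5 : l ≤ (1 - θ) * (1 - θ) := by
            have : l = 1 - 2 * θ := by rw [hθ]; ring
            nlinarith
          have h6 : (1 - θ) * (x * γ i * t) ≤ (1 - θ) * ((1 - θ) * k) := by
            nlinarith
          exact le_of_mul_le_mul_left h6 (by rw [hθ]; linarith)
        nlinarith
      push_cast
      have := ih i
      nlinarith
  refine ⟨(1 - θ) * (c * (v i)⁻¹), by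
    have : 0 < 1 - θ := by rw [hθ]; linarith
    have := hv i
    positivity, ?_⟩
  filter_upwards [eventually_ge_atTop T] with t ht
  have h1 := (hT t ht).1 i
  have h2 := mul_le_mul_of_nonneg_left (key t ht i) (by rw [hθ]; linarith : 0 ≤ 1 - θ)
  linarith

/-- A bound `r` on the odds relative to `v` improves by a factor arbitrarily close to `l`. -/
theorem odds_le_improve (h : UrnTrajectory W γ B C S R) (hv : ∀ i, 0 < v i)
    (hev : ∀ i, γ i * ∑ j, W i j * v j = l * v i) {l' r : ℝ} (hl' : l < l') (hr : 0 < r)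
    (hB : ∀ᶠ t in atTop, ∀ i, B i t ≤ r * v i * C i t) :
    ∀ᶠ t in atTop, ∀ i, B i t ≤ l' * r * v i * C i t := by
  refine eventually_all.2 fun i => ?_
  obtain ⟨T, hT⟩ := eventually_atTop.1 (hB.and (eventually_ge_atTop 1))
  set a := l * r * v i with ha
  -- Each increment of `S i` is at most a times that of `R i`.
  have key : ∀ t ≥ T, S i t - a * R i t ≤ S i T - a * R i T := by
    intro t ht
    induction t, ht using Nat.le_induction with
    | base => exact le_rfl
    | succ t ht ih =>
      obtain ⟨h1, h3⟩ := hT t ht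
      have ht0 : (0 : ℝ) < t := Nat.cast_pos.2 h3
      rw [h.succ_right i t h3, h.succ_left i t h3]
      set k := ∑ j, W i j * C j t with hk
      set m := ∑ j, W i j * B j t with hm
      have hm0 : 0 < m := h.sum_pos i fun j => h.pos_left j t
      have hk0 : 0 < k := h.sum_pos i fun j => h.pos_right j t
      have hmk : m + k = t := h.sum_add_sum i h3
      have hg := h.bias_pos i
      set V := ∑ j, W i j * v j with hV
      have hV0 : 0 < V := h.sum_pos i hv
      have hJ := inv_sum_mul_le_sum_mul_inv (h.weight_nonneg i) (h.weight_sum i)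
        (x := fun j => 1 + r * v j) fun j => by have := hv j; positivity
      have hsum : ∑ j, W i j * (1 + r * v j) = 1 + r * V := by
        simp_rw [mul_add, mul_one, Finset.sum_add_distrib, h.weight_sum]
        rw [hV, Finset.mul_sum]
        congr 1
        exact Finset.sum_congr rfl fun j _ => by ring
      rw [hsum] at hJ
      -- Written as C j ≥ t / (1 + r v j), the odds bound can be averaged by the mean inequality: k
      -- ≥ t / (1 + r V), that is, m ≤ r V k.
      have hk1 : t * ∑ j, W i j * (1 + r * v j)⁻¹ ≤ k := by
        rw [Finset.mul_sum]
        refine le_trans (le_of_eq ?_) (h.sum_le i (x := fun j => t * (1 + r * v j)⁻¹)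
          fun j => ?_)
        · exact Finset.sum_congr rfl fun j _ => by ring
        · have := hv j
          rw [← div_eq_mul_inv, div_le_iff₀ (by positivity)]
          have := h1 j
          have := h.add_eq j t h3
          linarith
      have hk2 : t * (1 + r * V)⁻¹ ≤ k := le_trans (mul_le_mul_of_nonneg_left hJ ht0.le) hk1
      rw [← div_eq_mul_inv, div_le_iff₀ (by positivity)] at hk2
      have hmk' : m ≤ r * V * k := by nlinarith
      have hgm : γ i * m ≤ a * k := by
        have h5 := mul_le_mul_of_nonneg_left hmk' hg.le
        have h6 : γ i * (r * V * k) = a * k := by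
          rw [ha, mul_right_comm l, ← hev i]; ring
        linarith
      have : γ i * m / (γ i * m + k) ≤ a * (k / (γ i * m + k)) := by
        rw [← mul_div_assoc]
        gcongr
      linarith
  set K := S i T - a * R i T
  -- This expression bounds (B i t - l' r v i C i t) / R i t from above; K disappears in the limit,
  -- and l < l' makes the limit negative.
  have hlim : Tendsto (fun t => B i t / S i t * (a + K / R i t) - l' * r * v i * (C i t / R i t))
      atTop (𝓝 (1 * (a + 0) - l' * r * v i * 1)) :=
    ((h.ratio_left i).mul (((h.tendsto_right i).const_div_atTop K).const_add a)).sub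
      ((h.ratio_right i).const_mul _)
  have hneg : 1 * (a + 0) - l' * r * v i * 1 < 0 := by
    have : l * (r * v i) < l' * (r * v i) := mul_lt_mul_of_pos_right hl' (mul_pos hr (hv i))
    rw [ha]; linarith
  filter_upwards [hlim.eventually_lt_const hneg, eventually_ge_atTop T,
    (h.tendsto_left i).eventually_gt_atTop 0, (h.tendsto_right i).eventually_gt_atTop 0]
    with t h1 h2 h3 h4
  have h5 : B i t = B i t / S i t * S i t := by field_simp
  have h6 : S i t ≤ R i t * (a + K / R i t) := by
    have := key t h2
    rw [mul_add, mul_div_cancel₀ _ h4.ne']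
    linarith
  have h7 : l' * r * v i * C i t = R i t * (l' * r * v i * (C i t / R i t)) := by field_simp
  rw [h5, h7]
  calc _ ≤ B i t / S i t * (R i t * (a + K / R i t)) := by
        have := h.pos_left i t
        exact mul_le_mul_of_nonneg_left h6 (by positivity)
    _ = R i t * (B i t / S i t * (a + K / R i t)) := by ring
    _ ≤ _ := mul_le_mul_of_nonneg_left (by linarith) h4.le

/-- Consensus: the proportion of the first colour tends to `0`. -/
theorem tendsto_left_div (h : UrnTrajectory W γ B C S R) (hv : ∀ i, 0 < v i) (hl0 : 0 < l)
    (hl : l < 1) (hev : ∀ i, γ i * ∑ j, W i j * v j = l * v i) (i : ι) :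
    Tendsto (fun t : ℕ => B i t / t) atTop (𝓝 0) := by
  obtain ⟨l', hl1, hl2⟩ := exists_between hl
  have hl'0 : 0 < l' := hl0.trans hl1
  obtain ⟨r, hr0, hr⟩ : ∃ r > 0, ∀ᶠ t in atTop, ∀ i, B i t ≤ r * v i * C i t := by
    choose c hc0 hc using h.exists_linear_le_right hv hl0 hl hev
    have : ∀ᶠ r : ℝ in atTop, ∀ i, (c i)⁻¹ * (v i)⁻¹ ≤ r :=
      eventually_all.2 fun i => eventually_ge_atTop _
    obtain ⟨r, hr, hr0⟩ := (this.and (eventually_gt_atTop 0)).exists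
    refine ⟨r, hr0, eventually_all.2 fun i => ?_⟩
    filter_upwards [hc i, eventually_ge_atTop 1] with t h1 h2
    have hvi := hv i
    have hci := hc0 i
    have h3 : (c i)⁻¹ ≤ r * v i := by
      have := hr i
      rwa [← div_eq_mul_inv, div_le_iff₀ hvi] at this
    have h4 : (t : ℝ) ≤ (c i)⁻¹ * C i t := by
      rw [← div_eq_inv_mul, le_div_iff₀ hci]; linarith
    have := h.add_eq i t h2
    have h5 := h.pos_right i t
    have := mul_le_mul_of_nonneg_right h3 h5.le
    linarith
  have hpow : ∀ k : ℕ, ∀ᶠ t in atTop, ∀ i, B i t ≤ l' ^ k * r * v i * C i t := by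
    intro k
    induction k with
    | zero => simpa using hr
    | succ k ih =>
      have := h.odds_le_improve hv hev hl1 (by positivity) ih
      simpa [pow_succ', mul_assoc] using this
  rw [tendsto_order]
  refine ⟨fun a ha => Eventually.of_forall fun t =>
    ha.trans_le (div_nonneg (h.pos_left i t).le t.cast_nonneg), fun a ha => ?_⟩
  have h1 : Tendsto (fun k : ℕ => l' ^ k * (r * v i)) atTop (𝓝 0) := by
    simpa using (tendsto_pow_atTop_nhds_zero_of_lt_one hl'0.le hl2).mul_const (r * v i)
  obtain ⟨k, hk⟩ := (h1.eventually_lt_const ha).exists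
  filter_upwards [hpow k, eventually_ge_atTop 1] with t h2 h3
  have ht0 : (0 : ℝ) < t := Nat.cast_pos.2 h3
  rw [div_lt_iff₀ ht0]
  have h4 := h.add_eq i t h3
  have h5 := h.pos_right i t
  have h6 := h.pos_left i t
  calc B i t ≤ (l' ^ k * (r * v i)) * C i t := by have := h2 i; linarith
    _ < a * C i t := by gcongr
    _ ≤ a * t := by gcongr; linarith

/-! ### The growth exponent of the linearized recursion. -/

/-- The denominator of f differs from t by (γ i - 1) times the weighted ones, which is o(t); this
linearizes the recursion at `0`. -/
theorem tendsto_total_div (h : UrnTrajectory W γ B C S R)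
    (h0 : ∀ i, Tendsto (fun t : ℕ => B i t / t) atTop (𝓝 0)) (i : ι) :
    Tendsto (fun t : ℕ => (γ i * ∑ j, W i j * B j t + ∑ j, W i j * C j t) / t) atTop (𝓝 1) := by
  have h1 : Tendsto (fun t : ℕ => (γ i - 1) * ∑ j, W i j * (B j t / t) + 1) atTop
      (𝓝 ((γ i - 1) * ∑ j, W i j * 0 + 1)) :=
    ((tendsto_finsetSum _ fun j _ => (h0 j).const_mul _).const_mul _).add_const _
  simp only [mul_zero, Finset.sum_const_zero, zero_add] at h1
  refine h1.congr' ?_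
  filter_upwards [eventually_ge_atTop 1] with t ht
  have ht0 : (0 : ℝ) < t := Nat.cast_pos.2 ht
  have := h.sum_add_sum i ht
  simp_rw [← mul_div_assoc, ← Finset.sum_div]
  field_simp
  linarith

theorem eventually_succ_le (h : UrnTrajectory W γ B C S R)
    (h0 : ∀ i, Tendsto (fun t : ℕ => B i t / t) atTop (𝓝 0)) {b : ℝ} (hb : 1 < b) :
    ∀ᶠ t : ℕ in atTop, ∀ i, S i (t + 1) ≤ S i t + b * (γ i * ∑ j, W i j * S j t) / t := by
  -- One factor q pays for replacing `B` by `S`, the other for replacing the denominator by t.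
  obtain ⟨q, hq⟩ : ∃ q, q = √b := ⟨_, rfl⟩
  have hq1 : 1 < q := by rw [hq]; exact Real.lt_sqrt_of_sq_lt (by simpa using hb)
  have hqq : q * q = b := by rw [hq]; exact Real.mul_self_sqrt (by linarith)
  have hqi : q⁻¹ < 1 := inv_lt_one_of_one_lt₀ hq1
  filter_upwards [h.eventually_left_le hq1, eventually_ge_atTop 1,
    eventually_all.2 fun i => (h.tendsto_total_div h0 i).eventually_const_le hqi] with t h1 h2 h3 i
  have ht0 : (0 : ℝ) < t := Nat.cast_pos.2 h2
  have h4 := h3 i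
  rw [h.succ_left i t h2]
  rw [le_div_iff₀ ht0] at h4
  have hg := h.bias_pos i
  have h5 : ∑ j, W i j * B j t ≤ q * ∑ j, W i j * S j t := by
    rw [Finset.mul_sum]
    refine (h.sum_le i h1).trans (le_of_eq (Finset.sum_congr rfl fun j _ => by ring))
  have hm0 : 0 < ∑ j, W i j * B j t := h.sum_pos i fun j => h.pos_left j t
  refine add_le_add le_rfl ?_
  have h6 : 0 ≤ q * ∑ j, W i j * S j t := hm0.le.trans h5
  calc _ ≤ γ i * (q * ∑ j, W i j * S j t) / (q⁻¹ * t) := by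
        gcongr
    _ = _ := by rw [← hqq]; field_simp

theorem eventually_le_succ (h : UrnTrajectory W γ B C S R)
    (h0 : ∀ i, Tendsto (fun t : ℕ => B i t / t) atTop (𝓝 0)) {b : ℝ} (hb0 : 0 < b) (hb : b < 1) :
    ∀ᶠ t : ℕ in atTop, ∀ i, S i t + b * (γ i * ∑ j, W i j * S j t) / t ≤ S i (t + 1) := by
  obtain ⟨q, hq⟩ : ∃ q, q = √b := ⟨_, rfl⟩
  have hq0 : 0 < q := by rw [hq]; exact Real.sqrt_pos.2 hb0
  have hq1 : q < 1 := by rw [hq, Real.sqrt_lt' one_pos]; simpa using hb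
  have hqq : q * q = b := by rw [hq]; exact Real.mul_self_sqrt hb0.le
  have hqi : 1 < q⁻¹ := (one_lt_inv₀ hq0).2 hq1
  filter_upwards [h.eventually_left_ge hq1, eventually_ge_atTop 1,
    eventually_all.2 fun i => (h.tendsto_total_div h0 i).eventually_le_const hqi] with t h1 h2 h3 i
  have ht0 : (0 : ℝ) < t := Nat.cast_pos.2 h2
  have h4 := h3 i
  rw [h.succ_left i t h2]
  rw [div_le_iff₀ ht0] at h4
  have hg := h.bias_pos i
  have h5 : q * ∑ j, W i j * S j t ≤ ∑ j, W i j * B j t := by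
    rw [Finset.mul_sum]
    refine le_trans (le_of_eq (Finset.sum_congr rfl fun j _ => by ring)) (h.sum_le i h1)
  have hm0 : 0 < ∑ j, W i j * B j t := h.sum_pos i fun j => h.pos_left j t
  have hk0 : 0 < ∑ j, W i j * C j t := h.sum_pos i fun j => h.pos_right j t
  refine add_le_add le_rfl ?_
  calc _ = γ i * (q * ∑ j, W i j * S j t) / (q⁻¹ * t) := by rw [← hqq]; field_simp
    _ ≤ γ i * (∑ j, W i j * B j t) / (q⁻¹ * t) := by gcongr
    _ ≤ _ := by gcongr

theorem exists_le_rpow (h : UrnTrajectory W γ B C S R)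
    (h0 : ∀ i, Tendsto (fun t : ℕ => B i t / t) atTop (𝓝 0)) (hv : ∀ i, 0 < v i) (hl0 : 0 < l)
    (hev : ∀ i, γ i * ∑ j, W i j * v j = l * v i) {a : ℝ} (ha : l < a) (i : ι) :
    ∃ c, ∀ᶠ t : ℕ in atTop, S i t ≤ c * (t : ℝ) ^ a := by
  obtain ⟨b, hb1, hb2⟩ := exists_between ha
  obtain ⟨T, hT⟩ := eventually_atTop.1 ((h.eventually_succ_le h0 (b := b / l)
    ((one_lt_div hl0).2 hb1)).and ((eventually_le_succ_rpow hb2).and (eventually_gt_atTop 0)))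
  have hT0 : (0 : ℝ) < T := Nat.cast_pos.2 (hT T le_rfl).2.2
  obtain ⟨c, hc, hc0⟩ : ∃ c : ℝ, (∀ i, S i T / (v i * (T : ℝ) ^ a) ≤ c) ∧ 0 < c :=
    ((eventually_all.2 fun i => eventually_ge_atTop _).and (eventually_gt_atTop 0)).exists
  -- Supersolution: Γ W v = l v turns the coefficient b / l into b, and b < a.
  have key : ∀ t ≥ T, ∀ i, S i t ≤ c * v i * (t : ℝ) ^ a := by
    intro t ht
    induction t, ht using Nat.le_induction with
    | base =>
      intro i
      have := hc i
      have hvi := hv i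
      rw [div_le_iff₀ (by positivity)] at this
      linarith
    | succ t ht ih =>
      intro i
      obtain ⟨h1, h2, h3⟩ := hT t ht
      have ht0 : (0 : ℝ) < t := Nat.cast_pos.2 h3
      have hg := h.bias_pos i
      have hvi := hv i
      have h4 : γ i * ∑ j, W i j * S j t ≤ c * (t : ℝ) ^ a * (l * v i) := by
        rw [← hev i, mul_left_comm]
        refine mul_le_mul_of_nonneg_left ?_ hg.le
        rw [Finset.mul_sum]
        exact (h.sum_le i ih).trans (le_of_eq (Finset.sum_congr rfl fun j _ => by ring))
      calc S i (t + 1) ≤ S i t + b / l * (γ i * ∑ j, W i j * S j t) / t := h1 i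
        _ ≤ c * v i * (t : ℝ) ^ a + b / l * (c * (t : ℝ) ^ a * (l * v i)) / t := by
            have : 0 < b := hl0.trans hb1
            gcongr
            exact ih i
        _ = c * v i * ((t : ℝ) ^ a + b * (t : ℝ) ^ a / t) := by field_simp
        _ ≤ _ := by gcongr
  exact ⟨c * v i, eventually_atTop.2 ⟨T, fun t ht => key t ht i⟩⟩

theorem exists_rpow_le (h : UrnTrajectory W γ B C S R)
    (h0 : ∀ i, Tendsto (fun t : ℕ => B i t / t) atTop (𝓝 0)) (hv : ∀ i, 0 < v i) (hl0 : 0 < l)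
    (hev : ∀ i, γ i * ∑ j, W i j * v j = l * v i) {a : ℝ} (ha : a < l) (i : ι) :
    ∃ c > 0, ∀ᶠ t : ℕ in atTop, c * (t : ℝ) ^ a ≤ S i t := by
  -- The maximum with 0 keeps b / l positive, as a may be negative.
  obtain ⟨b, hb1, hb2⟩ := exists_between (max_lt ha hl0)
  obtain ⟨hb1, hb0⟩ := max_lt_iff.1 hb1
  obtain ⟨T, hT⟩ := eventually_atTop.1 ((h.eventually_le_succ h0 (b := b / l) (by positivity)
    ((div_lt_one hl0).2 hb2)).and ((eventually_succ_rpow_le hb1).and ((eventually_gt_atTop 0).and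
    (eventually_all.2 fun i => (h.tendsto_left i).eventually_gt_atTop 0))))
  have hT0 : (0 : ℝ) < T := Nat.cast_pos.2 (hT T le_rfl).2.2.1
  obtain ⟨c, hc, hc0⟩ : ∃ c : ℝ, (∀ i, c * (v i * (T : ℝ) ^ a) ≤ S i T) ∧ 0 < c := by
    have : ∀ᶠ c : ℝ in 𝓝[>] 0, ∀ i, c * (v i * (T : ℝ) ^ a) ≤ S i T := by
      refine eventually_nhdsWithin_of_eventually_nhds (eventually_all.2 fun i => ?_)
      have h1 : Tendsto (fun c : ℝ => c * (v i * (T : ℝ) ^ a)) (𝓝 0) (𝓝 0) := by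
        simpa using (tendsto_id (x := 𝓝 (0 : ℝ))).mul_const (v i * (T : ℝ) ^ a)
      exact h1.eventually_le_const ((hT T le_rfl).2.2.2 i)
    exact (this.and self_mem_nhdsWithin).exists
  have key : ∀ t ≥ T, ∀ i, c * v i * (t : ℝ) ^ a ≤ S i t := by
    intro t ht
    induction t, ht using Nat.le_induction with
    | base =>
      intro i
      have := hc i
      linarith
    | succ t ht ih =>
      intro i
      obtain ⟨h1, h2, h3, -⟩ := hT t ht
      have ht0 : (0 : ℝ) < t := Nat.cast_pos.2 h3
      have hg := h.bias_pos i
      have hvi := hv i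
      have h4 : c * (t : ℝ) ^ a * (l * v i) ≤ γ i * ∑ j, W i j * S j t := by
        rw [← hev i, mul_left_comm]
        refine mul_le_mul_of_nonneg_left ?_ hg.le
        rw [Finset.mul_sum]
        exact le_trans (le_of_eq (Finset.sum_congr rfl fun j _ => by ring)) (h.sum_le i ih)
      calc _ ≤ c * v i * ((t : ℝ) ^ a + b * (t : ℝ) ^ a / t) := by gcongr
        _ = c * v i * (t : ℝ) ^ a + b / l * (c * (t : ℝ) ^ a * (l * v i)) / t := by field_simp
        _ ≤ S i t + b / l * (γ i * ∑ j, W i j * S j t) / t := by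
            gcongr
            exact ih i
        _ ≤ S i (t + 1) := h1 i
  exact ⟨c * v i, mul_pos hc0 (hv i), eventually_atTop.2 ⟨T, fun t ht => key t ht i⟩⟩

/-- The proportion of the first colour decays like `t ^ (l - 1)` up to subpolynomial factors. -/
theorem tendsto_div_rpow (h : UrnTrajectory W γ B C S R) (hv : ∀ i, 0 < v i) (hl0 : 0 < l)
    (hl : l < 1) (hev : ∀ i, γ i * ∑ j, W i j * v j = l * v i) (i : ι) {ε : ℝ} (hε : 0 < ε) :
    Tendsto (fun t : ℕ => B i t / t / (t : ℝ) ^ (l - 1 + ε)) atTop (𝓝 0) ∧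
      Tendsto (fun t : ℕ => B i t / t / (t : ℝ) ^ (l - 1 - ε)) atTop atTop := by
  have h0 := h.tendsto_left_div hv hl0 hl hev
  have hdiv : ∀ (t : ℕ), 0 < t → ∀ x a : ℝ, x * (t : ℝ) ^ a / t = x * (t : ℝ) ^ (a - 1) := by
    intro t ht x a
    have : (0 : ℝ) < t := Nat.cast_pos.2 ht
    rw [Real.rpow_sub_one this.ne', mul_div_assoc]
  have hpow : Tendsto (fun t : ℕ => (t : ℝ) ^ (ε / 2)) atTop atTop :=
    (tendsto_rpow_atTop (half_pos hε)).comp tendsto_natCast_atTop_atTop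
  constructor
  -- Half of ε is spent on the growth exponent; the other half leaves a factor t ^ (-ε/2).
  · obtain ⟨c, hc⟩ := h.exists_le_rpow h0 hv hl0 hev (a := l + ε / 2) (by linarith) i
    have hlim : Tendsto (fun t : ℕ => 2 * c / (t : ℝ) ^ (ε / 2)) atTop (𝓝 0) :=
      hpow.const_div_atTop _
    refine squeeze_zero' (Eventually.of_forall fun t => ?_) ?_ hlim
    · have := h.pos_left i t
      positivity
    · filter_upwards [hc, h.eventually_left_le one_lt_two, eventually_gt_atTop 0] with t h1 h2 h3
      have ht0 : (0 : ℝ) < t := Nat.cast_pos.2 h3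
      calc _ ≤ 2 * c * (t : ℝ) ^ (l + ε / 2) / t / (t : ℝ) ^ (l - 1 + ε) := by
            gcongr
            have := h2 i
            linarith
        _ = _ := by
            rw [hdiv t h3, mul_div_assoc, ← Real.rpow_sub ht0, div_eq_mul_inv (2 * c),
              ← Real.rpow_neg ht0.le]
            congr 2
            ring
  · obtain ⟨c, hc0, hc⟩ := h.exists_rpow_le h0 hv hl0 hev (a := l - ε / 2) (by linarith) i
    refine tendsto_atTop_mono' _ ?_ (hpow.const_mul_atTop (half_pos hc0))
    filter_upwards [hc, h.eventually_left_ge one_half_lt_one, eventually_gt_atTop 0] with t h1 h2 h3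
    have ht0 : (0 : ℝ) < t := Nat.cast_pos.2 h3
    calc _ = c / 2 * (t : ℝ) ^ (l - ε / 2) / t / (t : ℝ) ^ (l - 1 - ε) := by
          rw [hdiv t h3, mul_div_assoc, ← Real.rpow_sub ht0]
          congr 2
          ring
      _ ≤ _ := by
          gcongr
          have := h2 i
          linarith

end UrnTrajectory

/-! ### Conditional Borel–Cantelli by multiplicative martingales. -/

section ConditionalBorelCantelli

variable {Ω : Type*} {m0 : MeasurableSpace Ω} {P : Measure Ω} [IsProbabilityMeasure P]
  {ℱ : Filtration ℕ m0} {ξ p : ℕ → Ω → ℝ}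

/-- The multiplicative martingale of a `0`-`1` sequence with conditional means `p`. -/
def prodMartingale (ξ p : ℕ → Ω → ℝ) (a : ℝ) (n : ℕ) (ω : Ω) : ℝ :=
  ∏ k ∈ Finset.range n, (1 + a * ξ k ω) / (1 + a * p k ω)

theorem min_le_one_add_mul {a x : ℝ} (hx0 : 0 ≤ x) (hx1 : x ≤ 1) :
    min 1 (1 + a) ≤ 1 + a * x := by
  rcases le_total 0 a with ha | ha
  · exact (min_le_left _ _).trans (by nlinarith)
  · exact (min_le_right _ _).trans (by nlinarith)

theorem one_add_mul_le {a x : ℝ} (hx0 : 0 ≤ x) (hx1 : x ≤ 1) : 1 + a * x ≤ 1 + |a| := by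
  have : a * x ≤ |a| * x := mul_le_mul_of_nonneg_right (le_abs_self a) hx0
  have : |a| * x ≤ |a| * 1 := mul_le_mul_of_nonneg_left hx1 (abs_nonneg a)
  linarith

theorem prodMartingale_nonneg (hξ : ∀ k ω, ξ k ω = 0 ∨ ξ k ω = 1)
    (hp : ∀ k ω, 0 ≤ p k ω ∧ p k ω ≤ 1) {a : ℝ} (ha : -1 < a) (n : ℕ) (ω : Ω) :
    0 ≤ prodMartingale ξ p a n ω := by
  have hd : 0 < min 1 (1 + a) := lt_min one_pos (by linarith)
  refine Finset.prod_nonneg fun k _ => div_nonneg ?_ ?_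
  · rcases hξ k ω with h | h <;> rw [h] <;> linarith
  · exact hd.le.trans (min_le_one_add_mul (hp k ω).1 (hp k ω).2)

theorem prodMartingale_le (hξ : ∀ k ω, ξ k ω = 0 ∨ ξ k ω = 1)
    (hp : ∀ k ω, 0 ≤ p k ω ∧ p k ω ≤ 1) {a : ℝ} (ha : -1 < a) (n : ℕ) (ω : Ω) :
    prodMartingale ξ p a n ω ≤ ((1 + |a|) / min 1 (1 + a)) ^ n := by
  have hd : 0 < min 1 (1 + a) := lt_min one_pos (by linarith)
  have hξ' : ∀ k, 0 ≤ ξ k ω ∧ ξ k ω ≤ 1 := fun k => by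
    rcases hξ k ω with h | h <;> rw [h] <;> norm_num
  calc _ ≤ ∏ k ∈ Finset.range n, (1 + |a|) / min 1 (1 + a) := by
        refine Finset.prod_le_prod (fun k _ => div_nonneg ?_ ?_) fun k _ =>
          div_le_div₀ (by positivity) (one_add_mul_le (hξ' k).1 (hξ' k).2) hd
            (min_le_one_add_mul (hp k ω).1 (hp k ω).2)
        · exact hd.le.trans (min_le_one_add_mul (hξ' k).1 (hξ' k).2)
        · exact hd.le.trans (min_le_one_add_mul (hp k ω).1 (hp k ω).2)
    _ = _ := by simp only [Finset.prod_const, Finset.card_range]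

/-- Given the past, 1 + a ξ has mean 1 + a p, so each new factor has conditional mean 1; for a > -1
the denominators stay away from 0. -/
theorem martingale_prodMartingale (hξ : ∀ k ω, ξ k ω = 0 ∨ ξ k ω = 1)
    (hξm : ∀ k, StronglyMeasurable[ℱ (k + 1)] (ξ k))
    (hp : ∀ k ω, 0 ≤ p k ω ∧ p k ω ≤ 1) (hpm : ∀ k, StronglyMeasurable[ℱ k] (p k))
    (hc : ∀ k, P[ξ k | ℱ k] =ᵐ[P] p k) {a : ℝ} (ha : -1 < a) :
    Martingale (prodMartingale ξ p a) ℱ P := by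
  have hd : 0 < min 1 (1 + a) := lt_min one_pos (by linarith)
  have hm1 : ∀ k, StronglyMeasurable[ℱ k] fun ω => 1 + a * p k ω := fun k =>
    stronglyMeasurable_const.add ((hpm k).const_mul a)
  have hm2 : ∀ k, StronglyMeasurable[ℱ (k + 1)] fun ω => 1 + a * ξ k ω := fun k =>
    stronglyMeasurable_const.add ((hξm k).const_mul a)
  have hpos : ∀ k ω, 0 < 1 + a * p k ω := fun k ω =>
    hd.trans_le (min_le_one_add_mul (hp k ω).1 (hp k ω).2)
  have hadp : StronglyAdapted ℱ (prodMartingale ξ p a) := by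
    intro n
    induction n with
    | zero =>
      have : prodMartingale ξ p a 0 = fun _ => 1 := by ext ω; simp [prodMartingale]
      rw [this]
      exact stronglyMeasurable_const
    | succ n ih =>
      have : prodMartingale ξ p a (n + 1) = fun ω =>
          prodMartingale ξ p a n ω * ((1 + a * ξ n ω) / (1 + a * p n ω)) := by
        ext ω; simp only [prodMartingale, Finset.prod_range_succ]
      rw [this]
      exact (ih.mono (ℱ.mono n.le_succ)).mul ((hm2 n).div₀ ((hm1 n).mono (ℱ.mono n.le_succ))
        (fun ω => (hpos n ω).ne'))
  have hbdd : ∀ n ω, ‖prodMartingale ξ p a n ω‖ ≤ ((1 + |a|) / min 1 (1 + a)) ^ n := fun n ω => by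
    rw [Real.norm_of_nonneg (prodMartingale_nonneg hξ hp ha n ω)]
    exact prodMartingale_le hξ hp ha n ω
  have hint : ∀ n, Integrable (prodMartingale ξ p a n) P := fun n =>
    Integrable.of_bound ((hadp n).mono (ℱ.le n)).aestronglyMeasurable _
      (Eventually.of_forall (hbdd n))
  have hξint : ∀ k, Integrable (ξ k) P := fun k =>
    Integrable.of_bound ((hξm k).mono (ℱ.le _)).aestronglyMeasurable 1
      (Eventually.of_forall fun ω => by rcases hξ k ω with h | h <;> simp [h])
  refine martingale_nat hadp hint fun n => ?_
  set f : Ω → ℝ := fun ω => prodMartingale ξ p a n ω / (1 + a * p n ω) with hf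
  have hfm : StronglyMeasurable[ℱ n] f := (hadp n).div₀ (hm1 n) fun ω => (hpos n ω).ne'
  have hfb : ∀ ω, ‖f ω‖ ≤ ((1 + |a|) / min 1 (1 + a)) ^ n / min 1 (1 + a) := fun ω => by
    rw [hf, norm_div, Real.norm_of_nonneg (hpos n ω).le]
    exact div_le_div₀ (by positivity) (hbdd n ω) hd (min_le_one_add_mul (hp n ω).1 (hp n ω).2)
  have hsucc : prodMartingale ξ p a (n + 1) = f * ((fun _ => (1 : ℝ)) + a • ξ n) := by
    ext ω
    simp only [prodMartingale, Finset.prod_range_succ, hf, Pi.mul_apply, Pi.add_apply,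
      Pi.smul_apply, smul_eq_mul]
    ring
  rw [hsucc]
  have h1 := condExp_stronglyMeasurable_mul_of_bound (μ := P) (ℱ.le n) hfm
    ((integrable_const (1 : ℝ)).add ((hξint n).smul a)) _ (Eventually.of_forall hfb)
  have h2 := condExp_add (μ := P) (integrable_const (1 : ℝ)) ((hξint n).smul a) (ℱ n)
  have h3 := condExp_smul (μ := P) a (ξ n) (ℱ n)
  have h4 : P[fun _ : Ω => (1 : ℝ) | ℱ n] = fun _ => 1 := condExp_const (ℱ.le n) 1
  filter_upwards [h1, h2, h3, hc n] with ω e1 e2 e3 e4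
  rw [e1, Pi.mul_apply, e2, Pi.add_apply, e3, h4, Pi.smul_apply, e4, smul_eq_mul, hf]
  exact (div_mul_cancel₀ _ (hpos n ω).ne').symm

/-- Exponential comparison of a `0`-`1` sequence with its conditional means. -/
theorem ae_exists_sum_mul_log_le (hξ : ∀ k ω, ξ k ω = 0 ∨ ξ k ω = 1)
    (hξm : ∀ k, StronglyMeasurable[ℱ (k + 1)] (ξ k))
    (hp : ∀ k ω, 0 ≤ p k ω ∧ p k ω ≤ 1) (hpm : ∀ k, StronglyMeasurable[ℱ k] (p k))
    (hc : ∀ k, P[ξ k | ℱ k] =ᵐ[P] p k) {a : ℝ} (ha : -1 < a) :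
    ∀ᵐ ω ∂P, ∃ M, ∀ n, (∑ k ∈ Finset.range n, ξ k ω) * Real.log (1 + a) ≤
      M + a * ∑ k ∈ Finset.range n, p k ω := by
  have hd : 0 < min 1 (1 + a) := lt_min one_pos (by linarith)
  have hmart := martingale_prodMartingale hξ hξm hp hpm hc ha
  have hpos : ∀ k ω, 0 < 1 + a * p k ω := fun k ω =>
    hd.trans_le (min_le_one_add_mul (hp k ω).1 (hp k ω).2)
  have hposξ : ∀ k ω, 0 < 1 + a * ξ k ω := fun k ω => by
    rcases hξ k ω with h | h <;> rw [h] <;> linarith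
  have hbdd : ∀ n, eLpNorm (prodMartingale ξ p a n) 1 P ≤ (1 : NNReal) := by
    intro n
    rw [eLpNorm_one_eq_lintegral_enorm, ← ofReal_integral_norm_eq_lintegral_enorm
      (hmart.integrable n)]
    have h1 : ∫ ω, ‖prodMartingale ξ p a n ω‖ ∂P = ∫ ω, prodMartingale ξ p a n ω ∂P :=
      integral_congr_ae (Eventually.of_forall fun ω =>
        Real.norm_of_nonneg (prodMartingale_nonneg hξ hp ha n ω))
    have h2 := hmart.setIntegral_eq (Nat.zero_le n) MeasurableSet.univ
    simp only [Measure.restrict_univ] at h2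
    rw [h1, ← h2]
    simp [prodMartingale]
  -- Being nonnegative of mean 1, the martingale is bounded in L¹; it converges, so its paths are
  -- bounded.
  filter_upwards [hmart.submartingale.exists_ae_tendsto_of_bdd hbdd] with ω ⟨c, hlim⟩
  obtain ⟨K, hK⟩ := hlim.bddAbove_range
  have hK1 : ∀ n, prodMartingale ξ p a n ω ≤ K := fun n => hK ⟨n, rfl⟩
  refine ⟨Real.log K, fun n => ?_⟩
  have hZ : 0 < prodMartingale ξ p a n ω := Finset.prod_pos fun k _ => div_pos (hposξ k ω) (hpos k ω)
  have h1 := Real.log_le_log hZ (hK1 n)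
  rw [prodMartingale, Real.log_prod (fun k _ => (div_pos (hposξ k ω) (hpos k ω)).ne')] at h1
  -- Since ξ is 0 or 1, log (1 + a ξ) = ξ log (1 + a), while log (1 + a p) ≤ a p.
  have h2 : ∀ k ∈ Finset.range n, ξ k ω * Real.log (1 + a) - a * p k ω ≤
      Real.log ((1 + a * ξ k ω) / (1 + a * p k ω)) := by
    intro k _
    rw [Real.log_div (hposξ k ω).ne' (hpos k ω).ne']
    have h3 := Real.log_le_sub_one_of_pos (hpos k ω)
    have h4 : ξ k ω * Real.log (1 + a) = Real.log (1 + a * ξ k ω) := by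
      rcases hξ k ω with h | h <;> simp [h]
    linarith
  have h3 := (Finset.sum_le_sum h2).trans h1
  rw [Finset.sum_sub_distrib, ← Finset.sum_mul, ← Finset.mul_sum] at h3
  linarith

/-- The conditional second Borel-Cantelli lemma in its ratio form. -/
theorem ae_tendsto_sum_div_sum (hξ : ∀ k ω, ξ k ω = 0 ∨ ξ k ω = 1)
    (hξm : ∀ k, StronglyMeasurable[ℱ (k + 1)] (ξ k))
    (hp : ∀ k ω, 0 ≤ p k ω ∧ p k ω ≤ 1) (hpm : ∀ k, StronglyMeasurable[ℱ k] (p k))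
    (hc : ∀ k, P[ξ k | ℱ k] =ᵐ[P] p k) :
    ∀ᵐ ω ∂P, Tendsto (fun n => ∑ k ∈ Finset.range n, p k ω) atTop atTop →
      Tendsto (fun n => (∑ k ∈ Finset.range n, ξ k ω) / ∑ k ∈ Finset.range n, p k ω)
        atTop (𝓝 1) := by
  -- Countably many a = ±1/(j+2) share one null set; the shift by 2 keeps a above -1. Positive a
  -- bounds the ratio above by nearly a / log (1 + a), negative a below, as the logarithm changes
  -- sign.
  have hu : ∀ j : ℕ, -1 < 1 / ((j : ℝ) + 2) ∧ -1 < -(1 / ((j : ℝ) + 2)) ∧ 0 < 1 / ((j : ℝ) + 2) := by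
    intro j
    have h1 : 0 < 1 / ((j : ℝ) + 2) := by positivity
    have h2 : 1 / ((j : ℝ) + 2) < 1 := by
      rw [div_lt_one (by positivity)]; have := j.cast_nonneg (α := ℝ); linarith
    exact ⟨by linarith, by linarith, h1⟩
  have hlim0 : Tendsto (fun j : ℕ => 1 / ((j : ℝ) + 2)) atTop (𝓝 0) :=
    (tendsto_natCast_atTop_atTop.atTop_add tendsto_const_nhds).const_div_atTop 1
  have hslope : Tendsto (fun a : ℝ => a / Real.log (1 + a)) (𝓝[≠] 0) (𝓝 1) := by
    have h1 : HasDerivAt (fun a : ℝ => Real.log (1 + a)) 1 0 := by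
      have := (Real.hasDerivAt_log (x := 1 + 0) (by norm_num)).comp_const_add 1 0
      simpa using this
    have h2 := (h1.tendsto_slope).inv₀ one_ne_zero
    rw [inv_one] at h2
    refine h2.congr fun a => ?_
    simp [slope_def_field]
  have h1 := ae_all_iff.2 fun j : ℕ => ae_exists_sum_mul_log_le hξ hξm hp hpm hc (hu j).1
  have h2 := ae_all_iff.2 fun j : ℕ => ae_exists_sum_mul_log_le hξ hξm hp hpm hc (hu j).2.1
  filter_upwards [h1, h2] with ω h1 h2 hS
  have hlim : ∀ M a : ℝ, Tendsto (fun n => (M / (∑ k ∈ Finset.range n, p k ω) + a) /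
      Real.log (1 + a)) atTop (𝓝 (a / Real.log (1 + a))) := fun M a => by
    simpa using ((hS.const_div_atTop M).add_const a).div_const (Real.log (1 + a))
  have hval : ∀ n, 0 < (∑ k ∈ Finset.range n, p k ω) → ∀ M a : ℝ,
      (∑ k ∈ Finset.range n, ξ k ω) * Real.log (1 + a) ≤ M + a * ∑ k ∈ Finset.range n, p k ω →
      (∑ k ∈ Finset.range n, ξ k ω) / (∑ k ∈ Finset.range n, p k ω) * Real.log (1 + a) ≤
        M / (∑ k ∈ Finset.range n, p k ω) + a := by
    intro n hn M a h
    rw [div_mul_eq_mul_div, div_le_iff₀ hn, add_mul, div_mul_cancel₀ _ hn.ne']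
    exact h
  rw [tendsto_order]
  constructor
  · intro b hb
    have h3 : Tendsto (fun j : ℕ => -(1 / ((j : ℝ) + 2))) atTop (𝓝[≠] 0) :=
      tendsto_nhdsWithin_iff.2 ⟨by simpa using hlim0.neg, Eventually.of_forall fun j =>
        (neg_neg_of_pos (hu j).2.2).ne⟩
    obtain ⟨j, hj⟩ := ((hslope.comp h3).eventually_const_lt hb).exists
    obtain ⟨M, hM⟩ := h2 j
    have hlog : Real.log (1 + -(1 / ((j : ℝ) + 2))) < 0 :=
      Real.log_neg (by have := (hu j).2.1; linarith) (by have := (hu j).2.2; linarith)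
    filter_upwards [(hlim M _).eventually_const_lt hj, hS.eventually_gt_atTop 0] with n e1 e2
    refine e1.trans_le ?_
    rw [div_le_iff_of_neg hlog]
    exact hval n e2 M _ (hM n)
  · intro b hb
    have h3 : Tendsto (fun j : ℕ => 1 / ((j : ℝ) + 2)) atTop (𝓝[≠] 0) :=
      tendsto_nhdsWithin_iff.2 ⟨hlim0, Eventually.of_forall fun j => (hu j).2.2.ne'⟩
    obtain ⟨j, hj⟩ := ((hslope.comp h3).eventually_lt_const hb).exists
    obtain ⟨M, hM⟩ := h1 j
    have hlog : 0 < Real.log (1 + 1 / ((j : ℝ) + 2)) :=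
      Real.log_pos (by have := (hu j).2.2; linarith)
    filter_upwards [(hlim M _).eventually_lt_const hj, hS.eventually_gt_atTop 0] with n e1 e2
    refine lt_of_le_of_lt ?_ e1
    rw [le_div_iff₀ hlog]
    exact hval n e2 M _ (hM n)

end ConditionalBorelCantelli

/-! ### The urn model in terms of counts. -/

namespace UrnModel

variable {n : ℕ} (N : UrnModel n)

theorem weightedDegree_pos (i : Fin n) : 0 < weightedDegree N.weight i := by
  obtain ⟨j, hj⟩ := N.irreducible.exists_entry_pos i
  rw [normalizedAdjacency, Matrix.diagonal_mul] at hj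
  refine lt_of_le_of_ne (Finset.sum_nonneg fun k _ => N.weight_nonneg i k) fun h => ?_
  rw [← h] at hj
  simp at hj

theorem normalizedAdjacency_apply (i j : Fin n) :
    normalizedAdjacency N.weight i j = (weightedDegree N.weight i)⁻¹ * N.weight i j := by
  rw [normalizedAdjacency, Matrix.diagonal_mul]

theorem sum_normalizedAdjacency (i : Fin n) : ∑ j, normalizedAdjacency N.weight i j = 1 := by
  simp_rw [normalizedAdjacency_apply, ← Finset.mul_sum]
  exact inv_mul_cancel₀ (N.weightedDegree_pos i).ne'

/-- The Perron eigenvector of `Γ W`. -/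
theorem exists_pos_eigenvector (i₀ : Fin n) : 0 < lambdaMax N.jacobianZero ∧
    ∃ v : Fin n → ℝ, (∀ i, 0 < v i) ∧ ∀ i, N.bias i *
      ∑ j, normalizedAdjacency N.weight i j * v j = lambdaMax N.jacobianZero * v i := by
  have : NeZero n := ⟨(Fin.pos i₀).ne'⟩
  have hJ : N.jacobianZero =
      Matrix.diagonal (fun i => N.bias i * (weightedDegree N.weight i)⁻¹) * N.weight := by
    rw [jacobianZero, normalizedAdjacency, ← Matrix.mul_assoc, Matrix.diagonal_mul_diagonal]
  obtain ⟨h0, v, hv, hev⟩ := exists_pos_eigenvector_lambdaMax (A := N.weight)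
    (s := fun i => N.bias i * (weightedDegree N.weight i)⁻¹) N.weight_symm N.weight_nonneg
    (fun i => mul_pos (N.bias_pos i) (inv_pos.2 (N.weightedDegree_pos i))) N.irreducible
    (fun i j hij => by
      rw [normalizedAdjacency_apply] at hij
      exact pos_of_mul_pos_right hij (inv_pos.2 (N.weightedDegree_pos i)).le)
  rw [hJ]
  refine ⟨h0, v, hv, fun i => ?_⟩
  rw [← hev i, mul_assoc, Finset.mul_sum _ _ (weightedDegree N.weight i)⁻¹]
  simp_rw [normalizedAdjacency_apply, mul_assoc]

/-- The number of declarations `1` of agent `i` up to time `t`, with the initial setting. -/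
def ones (h : Declarations n) (i : Fin n) (t : ℕ) : ℝ :=
  N.init i + ∑ τ ∈ Finset.Icc 2 t, if h τ i = true then 1 else 0

/-- The number of declarations `0` of agent `i` up to time `t`, with the initial setting. -/
def zeros (h : Declarations n) (i : Fin n) (t : ℕ) : ℝ :=
  1 - N.init i + ∑ τ ∈ Finset.Icc 2 t, if h τ i = false then 1 else 0

variable (h : Declarations n)

theorem init_le_ones (i : Fin n) (t : ℕ) : N.init i ≤ N.ones h i t :=
  le_add_of_nonneg_right (Finset.sum_nonneg fun _ _ => by split_ifs <;> simp)

theorem ones_pos (i : Fin n) (t : ℕ) : 0 < N.ones h i t :=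
  (N.init_pos i).trans_le (N.init_le_ones h i t)

theorem init_le_zeros (i : Fin n) (t : ℕ) : 1 - N.init i ≤ N.zeros h i t :=
  le_add_of_nonneg_right (Finset.sum_nonneg fun _ _ => by split_ifs <;> simp)

theorem zeros_pos (i : Fin n) (t : ℕ) : 0 < N.zeros h i t :=
  (sub_pos.2 (N.init_lt_one i)).trans_le (N.init_le_zeros h i t)

theorem ones_add_zeros (i : Fin n) {t : ℕ} (ht : 1 ≤ t) : N.ones h i t + N.zeros h i t = t := by
  have h1 : (∑ τ ∈ Finset.Icc 2 t, if h τ i = true then (1 : ℝ) else 0) +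
      ∑ τ ∈ Finset.Icc 2 t, (if h τ i = false then (1 : ℝ) else 0) = t - 1 := by
    rw [← Finset.sum_add_distrib, Finset.sum_congr rfl (g := fun _ => (1 : ℝ))]
    · rw [Finset.sum_const, Nat.card_Icc, nsmul_eq_mul, mul_one, Nat.cast_sub (by omega)]
      push_cast
      ring
    · intro τ _
      cases h τ i <;> simp
  rw [ones, zeros]
  linarith

theorem count1_eq (i : Fin n) (t : ℕ) : N.count1 h i t = weightedDegree N.weight i *
    ∑ j, normalizedAdjacency N.weight i j * N.ones h j t := by
  have hd := (N.weightedDegree_pos i).ne'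
  simp_rw [normalizedAdjacency_apply, mul_assoc, ← Finset.mul_sum]
  rw [mul_inv_cancel_left₀ hd, count1, Finset.sum_comm, ← Finset.sum_add_distrib]
  exact Finset.sum_congr rfl fun j _ => by rw [ones, mul_add, Finset.mul_sum]

theorem count0_eq (i : Fin n) (t : ℕ) : N.count0 h i t = weightedDegree N.weight i *
    ∑ j, normalizedAdjacency N.weight i j * N.zeros h j t := by
  have hd := (N.weightedDegree_pos i).ne'
  simp_rw [normalizedAdjacency_apply, mul_assoc, ← Finset.mul_sum]
  rw [mul_inv_cancel_left₀ hd, count0, Finset.sum_comm, ← Finset.sum_add_distrib]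
  exact Finset.sum_congr rfl fun j _ => by rw [zeros, mul_add, Finset.mul_sum]

theorem sum_mul_pos (i : Fin n) {x : Fin n → ℝ} (hx : ∀ j, 0 < x j) :
    0 < ∑ j, normalizedAdjacency N.weight i j * x j := by
  obtain ⟨j, hj⟩ := N.irreducible.exists_entry_pos i
  exact Finset.sum_pos' (fun k _ => mul_nonneg (N.irreducible.nonneg i k) (hx k).le)
    ⟨j, Finset.mem_univ _, mul_pos hj (hx j)⟩

/-- The degree cancels, and f takes a form in which the two colours play parallel roles, as in
`UrnTrajectory`. -/
theorem declareOneProb_eq (i : Fin n) (t : ℕ) : N.declareOneProb h i t =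
    N.bias i * (∑ j, normalizedAdjacency N.weight i j * N.ones h j t) /
      (N.bias i * ∑ j, normalizedAdjacency N.weight i j * N.ones h j t +
        ∑ j, normalizedAdjacency N.weight i j * N.zeros h j t) := by
  have hd := N.weightedDegree_pos i
  have hm := N.sum_mul_pos i fun j => N.ones_pos h j t
  have hk := N.sum_mul_pos i fun j => N.zeros_pos h j t
  have hg := N.bias_pos i
  rw [declareOneProb, biasedProb, mu, count1_eq, count0_eq]
  set m := ∑ j, normalizedAdjacency N.weight i j * N.ones h j t
  set k := ∑ j, normalizedAdjacency N.weight i j * N.zeros h j t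
  have h1 : weightedDegree N.weight i * m /
      (weightedDegree N.weight i * k + weightedDegree N.weight i * m) = m / (k + m) := by
    rw [← mul_add, mul_div_mul_left _ _ hd.ne']
  have h2 : 1 + (N.bias i - 1) * (m / (k + m)) = (N.bias i * m + k) / (k + m) := by
    field_simp
    ring
  rw [h1, h2]
  field_simp

theorem one_sub_declareOneProb_eq (i : Fin n) (t : ℕ) : 1 - N.declareOneProb h i t =
    (∑ j, normalizedAdjacency N.weight i j * N.zeros h j t) /
      (N.bias i * ∑ j, normalizedAdjacency N.weight i j * N.ones h j t +
        ∑ j, normalizedAdjacency N.weight i j * N.zeros h j t) := by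
  have hm := N.sum_mul_pos i fun j => N.ones_pos h j t
  have hk := N.sum_mul_pos i fun j => N.zeros_pos h j t
  have hg := N.bias_pos i
  rw [declareOneProb_eq, eq_div_iff (by positivity), sub_mul, div_mul_cancel₀ _ (by positivity)]
  ring

theorem declareOneProb_nonneg (i : Fin n) (t : ℕ) : 0 ≤ N.declareOneProb h i t := by
  have hm := N.sum_mul_pos i fun j => N.ones_pos h j t
  have hk := N.sum_mul_pos i fun j => N.zeros_pos h j t
  have hg := N.bias_pos i
  rw [declareOneProb_eq]
  positivity

theorem declareOneProb_le_one (i : Fin n) (t : ℕ) : N.declareOneProb h i t ≤ 1 := by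
  have hm := N.sum_mul_pos i fun j => N.ones_pos h j t
  have hk := N.sum_mul_pos i fun j => N.zeros_pos h j t
  have hg := N.bias_pos i
  rw [← sub_nonneg, one_sub_declareOneProb_eq]
  positivity

/-- The conditional probability that agent `i` declares `b` at time `t + 1`. -/
def declareProb (b : Bool) (h : Declarations n) (i : Fin n) (t : ℕ) : ℝ :=
  if b = true then N.declareOneProb h i t else 1 - N.declareOneProb h i t

theorem declareProb_mem (b : Bool) (i : Fin n) (t : ℕ) :
    0 ≤ N.declareProb b h i t ∧ N.declareProb b h i t ≤ 1 := by
  have h0 := N.declareOneProb_nonneg h i t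
  have h1 := N.declareOneProb_le_one h i t
  cases b <;> simp [declareProb, h0, h1]

/-- The initial settings bound the numerators below, and the denominators grow at most linearly.
Comparison with the harmonic series then makes the compensators diverge on every path. -/
theorem exists_div_le_declareProb (b : Bool) (i : Fin n) :
    ∃ c > 0, ∀ t : ℕ, 1 ≤ t → c / t ≤ N.declareProb b h i t := by
  have hg := N.bias_pos i
  have hx := N.sum_mul_pos i N.init_pos
  have hy := N.sum_mul_pos i fun j => sub_pos.2 (N.init_lt_one j)
  set x := ∑ j, normalizedAdjacency N.weight i j * N.init j with hxd
  set y := ∑ j, normalizedAdjacency N.weight i j * (1 - N.init j) with hyd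
  refine ⟨min (N.bias i * x) y / (N.bias i + 1), by positivity, fun t ht => ?_⟩
  have ht0 : (0 : ℝ) < t := Nat.cast_pos.2 ht
  have hm := N.sum_mul_pos i fun j => N.ones_pos h j t
  have hk := N.sum_mul_pos i fun j => N.zeros_pos h j t
  have hxm : x ≤ ∑ j, normalizedAdjacency N.weight i j * N.ones h j t :=
    Finset.sum_le_sum fun j _ =>
      mul_le_mul_of_nonneg_left (N.init_le_ones h j t) (N.irreducible.nonneg i j)
  have hyk : y ≤ ∑ j, normalizedAdjacency N.weight i j * N.zeros h j t :=
    Finset.sum_le_sum fun j _ =>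
      mul_le_mul_of_nonneg_left (N.init_le_zeros h j t) (N.irreducible.nonneg i j)
  have hsum : ∑ j, normalizedAdjacency N.weight i j * N.ones h j t +
      ∑ j, normalizedAdjacency N.weight i j * N.zeros h j t = t := by
    rw [← Finset.sum_add_distrib]
    simp_rw [← mul_add, N.ones_add_zeros h _ ht, ← Finset.sum_mul, sum_normalizedAdjacency, one_mul]
  have hden : N.bias i * ∑ j, normalizedAdjacency N.weight i j * N.ones h j t +
      ∑ j, normalizedAdjacency N.weight i j * N.zeros h j t ≤ (N.bias i + 1) * t := by
    rw [← hsum]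
    nlinarith
  rw [div_div]
  cases b
  · rw [declareProb, if_neg (by simp), one_sub_declareOneProb_eq]
    exact div_le_div₀ hk.le ((min_le_right _ _).trans hyk) (by positivity) hden
  · rw [declareProb, if_pos rfl, declareOneProb_eq]
    exact div_le_div₀ (by positivity) ((min_le_left _ _).trans
      (mul_le_mul_of_nonneg_left hxm hg.le)) (by positivity) hden

/-- The accumulated conditional probabilities of the declarations `b` of agent `i`. -/
def compensator (b : Bool) (h : Declarations n) (i : Fin n) (t : ℕ) : ℝ :=
  -- The times k + 1 = 1, …, t - 1 govern the declarations at 2, …, t.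
  ∑ k ∈ Finset.range (t - 1), N.declareProb b h i (k + 1)

theorem compensator_succ (b : Bool) (i : Fin n) {t : ℕ} (ht : 1 ≤ t) :
    N.compensator b h i (t + 1) = N.compensator b h i t + N.declareProb b h i t := by
  obtain ⟨s, rfl⟩ := Nat.exists_eq_add_of_le' ht
  simp [compensator, Finset.sum_range_succ]

theorem tendsto_sum_declareProb (b : Bool) (i : Fin n) :
    Tendsto (fun m => ∑ k ∈ Finset.range m, N.declareProb b h i (k + 1)) atTop atTop := by
  obtain ⟨c, hc, hle⟩ := N.exists_div_le_declareProb h b i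
  refine tendsto_atTop_mono (fun m => ?_)
    (Real.tendsto_sum_range_one_div_nat_succ_atTop.const_mul_atTop hc)
  rw [Finset.mul_sum]
  refine Finset.sum_le_sum fun k _ => ?_
  have := hle (k + 1) (by omega)
  push_cast at this
  rwa [mul_one_div]

theorem tendsto_compensator (b : Bool) (i : Fin n) :
    Tendsto (N.compensator b h i) atTop atTop :=
  (N.tendsto_sum_declareProb h b i).comp (tendsto_sub_atTop_nat 1)

theorem urnTrajectory
    (h1 : ∀ i, Tendsto (fun t => N.ones h i t / N.compensator true h i t) atTop (𝓝 1))
    (h0 : ∀ i, Tendsto (fun t => N.zeros h i t / N.compensator false h i t) atTop (𝓝 1)) :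
    UrnTrajectory (normalizedAdjacency N.weight) N.bias (N.ones h) (N.zeros h)
      (N.compensator true h) (N.compensator false h) where
  weight_nonneg := N.irreducible.nonneg
  weight_sum := N.sum_normalizedAdjacency
  bias_pos := N.bias_pos
  pos_left := N.ones_pos h
  pos_right := N.zeros_pos h
  add_eq i _ ht := N.ones_add_zeros h i ht
  succ_left i t ht := by
    rw [N.compensator_succ h _ _ ht, declareProb, if_pos rfl, declareOneProb_eq]
  succ_right i t ht := by
    rw [N.compensator_succ h _ _ ht, declareProb, if_neg (by simp), one_sub_declareOneProb_eq]
  tendsto_left := N.tendsto_compensator h true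
  tendsto_right := N.tendsto_compensator h false
  ratio_left := h1
  ratio_right := h0

end UrnModel

/-! ### From the conditional law to almost sure ratios. -/

section DeclarationProcess

variable {n : ℕ} {Ω : Type*} {m0 : MeasurableSpace Ω} {P : Measure Ω} {N : UrnModel n}
  {ψ : Ω → Declarations n}

/-- The histories up to the times `1, 2, …` as a filtration. -/
def IsDeclarationProcess.filtration (hψ : IsDeclarationProcess N P ψ) : Filtration ℕ m0 where
  -- Index 0 is time 1, so the variable revealed between indices k and k + 1 is the declaration at
  -- time k + 2.
  seq k := historySigma ψ (k + 1)
  mono' := fun _ _ hkl => biSup_mono fun _ hτ => ⟨hτ.1, hτ.2.trans (by omega)⟩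
  le' k := iSup₂_le fun τ hτ => iSup_le fun i => (hψ.measurable τ hτ.1 i).comap_le

theorem measurable_historySigma {t τ : ℕ} (h2 : 2 ≤ τ) (ht : τ ≤ t) (i : Fin n) :
    Measurable[historySigma ψ t] fun ω => ψ ω τ i := by
  refine Measurable.mono (comap_measurable _) ?_ le_rfl
  exact le_trans (le_iSup (fun i : Fin n => MeasurableSpace.comap (fun ω => ψ ω τ i) ⊤) i)
    (le_iSup₂ (f := fun τ (_ : τ ∈ Set.Icc 2 t) =>
      ⨆ i : Fin n, MeasurableSpace.comap (fun ω => ψ ω τ i) ⊤) τ ⟨h2, ht⟩)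

theorem measurable_indicator_historySigma {t τ : ℕ} (h2 : 2 ≤ τ) (ht : τ ≤ t) (i : Fin n)
    (b : Bool) : Measurable[historySigma ψ t] fun ω => if ψ ω τ i = b then (1 : ℝ) else 0 :=
  (measurable_from_top (f := fun x : Bool => if x = b then (1 : ℝ) else 0)).comp
    (measurable_historySigma h2 ht i)

theorem measurable_declareProb (b : Bool) (i : Fin n) (t : ℕ) :
    Measurable[historySigma ψ t] fun ω => N.declareProb b (ψ ω) i t := by
  have h1 : Measurable[historySigma ψ t] fun ω => N.count1 (ψ ω) i t :=
    measurable_const.add (Finset.measurable_fun_sum _ fun τ hτ => Finset.measurable_fun_sum _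
      fun j _ => (measurable_indicator_historySigma (Finset.mem_Icc.1 hτ).1
        (Finset.mem_Icc.1 hτ).2 j true).const_mul _)
  have h0 : Measurable[historySigma ψ t] fun ω => N.count0 (ψ ω) i t :=
    measurable_const.add (Finset.measurable_fun_sum _ fun τ hτ => Finset.measurable_fun_sum _
      fun j _ => (measurable_indicator_historySigma (Finset.mem_Icc.1 hτ).1
        (Finset.mem_Icc.1 hτ).2 j false).const_mul _)
  have hmu : Measurable[historySigma ψ t] fun ω => N.mu (ψ ω) i t := h1.div (h0.add h1)
  have hp : Measurable[historySigma ψ t] fun ω => N.declareOneProb (ψ ω) i t :=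
    (hmu.const_mul _).div (measurable_const.add (hmu.const_mul _))
  cases b
  · simpa [UrnModel.declareProb] using hp.const_sub 1
  · simpa [UrnModel.declareProb] using hp

/-- Marginalization: the sum of products factorizes over agents, and every factor other than that of
i sums to 1. -/
theorem sum_prod_declareProb (N : UrnModel n) (h : Declarations n) (b : Bool) (i : Fin n) (t : ℕ) :
    ∑ x ∈ Finset.univ.filter (fun x : Fin n → Bool => x i = b),
      ∏ j, N.declareProb (x j) h j t = N.declareProb b h i t := by
  have h1 : Finset.univ.filter (fun x : Fin n → Bool => x i = b) =
      Fintype.piFinset fun j => if j = i then {b} else Finset.univ := by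
    ext x
    simp only [Finset.mem_filter, Finset.mem_univ, true_and, Fintype.mem_piFinset]
    constructor
    · intro hx j
      by_cases hj : j = i
      · subst hj; simpa using hx
      · simp [hj]
    · intro hx
      simpa using hx i
  rw [h1, ← Finset.prod_univ_sum (fun j => if j = i then {b} else Finset.univ)
    (fun j y => N.declareProb y h j t), Finset.prod_eq_single i]
  · simp
  · intro j _ hj
    simp [hj, UrnModel.declareProb]
  · simp

theorem IsDeclarationProcess.condExp_indicator [IsProbabilityMeasure P]
    (hψ : IsDeclarationProcess N P ψ) {t : ℕ} (ht : 1 ≤ t) (b : Bool) (i : Fin n) :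
    P[fun ω => if ψ ω (t + 1) i = b then (1 : ℝ) else 0 | historySigma ψ t] =ᵐ[P]
      fun ω => N.declareProb b (ψ ω) i t := by
  have hmeas : ∀ x : Fin n → Bool, MeasurableSet {ω | ∀ i, ψ ω (t + 1) i = x i} := by
    intro x
    rw [Set.ofPred_forall]
    exact MeasurableSet.iInter fun j =>
      hψ.measurable (t + 1) (by omega) j (measurableSet_singleton (x j))
  have hint : ∀ x ∈ Finset.univ.filter (fun x : Fin n → Bool => x i = b),
      Integrable (Set.indicator {ω | ∀ i, ψ ω (t + 1) i = x i} fun _ => (1 : ℝ)) P :=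
    fun x _ => (integrable_const 1).indicator (hmeas x)
  have hsum : (fun ω => if ψ ω (t + 1) i = b then (1 : ℝ) else 0) =
      ∑ x ∈ Finset.univ.filter (fun x : Fin n → Bool => x i = b),
        Set.indicator {ω | ∀ i, ψ ω (t + 1) i = x i} fun _ => (1 : ℝ) := by
    ext ω
    rw [Finset.sum_apply]
    have : ∀ x : Fin n → Bool, Set.indicator {ω | ∀ i, ψ ω (t + 1) i = x i}
        (fun _ => (1 : ℝ)) ω = if ψ ω (t + 1) = x then 1 else 0 := by
      intro x
      simp [Set.indicator_apply, funext_iff]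
    simp_rw [this]
    rw [Finset.sum_ite_eq]
    simp
  rw [hsum]
  have h1 := condExp_finsetSum hint (historySigma ψ t)
  have h2 := ae_all_iff.2 fun x => hψ.cond_law t ht x
  filter_upwards [h1, h2] with ω e1 e2
  rw [e1, Finset.sum_apply, ← sum_prod_declareProb]
  exact Finset.sum_congr rfl fun x _ => e2 x

theorem IsDeclarationProcess.ae_tendsto_ratio [IsProbabilityMeasure P]
    (hψ : IsDeclarationProcess N P ψ) (b : Bool) (x : ℝ) (i : Fin n) :
    ∀ᵐ ω ∂P, Tendsto (fun t : ℕ => (x + ∑ τ ∈ Finset.Icc 2 t,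
      if ψ ω τ i = b then (1 : ℝ) else 0) / N.compensator b (ψ ω) i t) atTop (𝓝 1) := by
  have h := ae_tendsto_sum_div_sum (P := P) (ℱ := hψ.filtration)
    (ξ := fun k ω => if ψ ω (k + 2) i = b then (1 : ℝ) else 0)
    (p := fun k ω => N.declareProb b (ψ ω) i (k + 1))
    (fun k ω => (ite_eq_or_eq _ _ _).symm)
    (fun k => (measurable_indicator_historySigma (by omega) le_rfl i b).stronglyMeasurable)
    (fun k ω => N.declareProb_mem (ψ ω) b i (k + 1))
    (fun k => (measurable_declareProb b i (k + 1)).stronglyMeasurable)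
    (fun k => hψ.condExp_indicator (by omega) b i)
  filter_upwards [h] with ω h
  have hS := N.tendsto_sum_declareProb (ψ ω) b i
  -- The initial setting x is negligible against the divergent compensator.
  have h2 := (hS.const_div_atTop x).add (h hS)
  rw [zero_add] at h2
  rw [← tendsto_add_atTop_iff_nat 1]
  refine h2.congr fun m => ?_
  have h3 : ∑ τ ∈ Finset.Icc 2 (m + 1), (if ψ ω τ i = b then (1 : ℝ) else 0) =
      ∑ k ∈ Finset.range m, if ψ ω (k + 2) i = b then (1 : ℝ) else 0 := by
    rw [← Finset.Ico_add_one_right_eq_Icc, Finset.sum_Ico_eq_sum_range]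
    rw [show m + 1 + 1 - 2 = m by omega]
    simp_rw [add_comm 2]
  rw [h3, ← add_div]
  rfl

end DeclarationProcess

end

theorem mainTheorem6 {n : ℕ} (N : UrnModel n)
    (hN : lambdaMax N.jacobianZero < 1)
    {Ω : Type*} [MeasurableSpace Ω] (P : Measure Ω) [IsProbabilityMeasure P]
    (ψ : Ω → Declarations n) (hψ : IsDeclarationProcess N P ψ)
    (i : Fin n) (ε : ℝ) (hε : 0 < ε) :
    ∀ᵐ ω ∂P,
      Tendsto (fun t : ℕ => N.beta (ψ ω) i t / (t : ℝ) ^ (lambdaMax N.jacobianZero - 1 + ε))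
        atTop (𝓝 0) ∧
      Tendsto (fun t : ℕ => N.beta (ψ ω) i t / (t : ℝ) ^ (lambdaMax N.jacobianZero - 1 - ε))
        atTop atTop := by
  obtain ⟨hl0, v, hv, hev⟩ := N.exists_pos_eigenvector i
  have h1 := ae_all_iff.2 fun j => hψ.ae_tendsto_ratio true (N.init j) j
  have h0 := ae_all_iff.2 fun j => hψ.ae_tendsto_ratio false (1 - N.init j) j
  filter_upwards [h1, h0] with ω h1 h0
  exact (N.urnTrajectory (ψ ω) h1 h0).tendsto_div_rpow hv hl0 hN hev i hε
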